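/- For $d\ge 1$ let $Q_d$ be the hypercube graph: its vertices are the subsets of $\{1,\dots,d\}$, and two vertices are adjacent if they differ in exactly one element $i$; such an edge is said to be in direction $i$. A 1-factorization of $Q_d$ is a partition $\mathcal M=(M_1,\dots,M_d)$ of its edges into perfect matchings. Let $G[\mathcal M]$ be the graph with vertices $M_1,\dots,M_d$ in which $M_i$ and $M_j$ ($i\ne j$) are adjacent if and only if $M_i\cup M_j$ is a Hamilton cycle of $Q_d$. For integers $k,l\ge 1$, a 1-factorization $\mathcal M=(M_1,\dots,M_{k+l})$ of $Q_{k+l}$ is direction respecting if $M_1,\dots,M_k$ only use edges in directions $1,\dots,k$ and $M_{k+1},\dots,M_{k+l}$ only use edges in directions $k+1,\dots,k+l$. Theorem. Let $k,l\ge 1$ be integers. There is a direction respecting 1-factorization $\mathcal M$ of $Q_{k+l}$ such that $G[\mathcal M]$ is isomorphic to the complete bipartite graph $K_{k,l}$ if and only if $(k,l)\notin\{(3,1),(1,3),(3,3)\}$. -/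

import Mathlib

/-- The hypercube graph `Q_d`: vertices are the subsets of a `d`-element set, and two vertices are
adjacent when they differ in exactly one element. -/
def hypercube (d : ℕ) : SimpleGraph (Finset (Fin d)) where
  Adj s t := (symmDiff s t).card = 1
  symm := ⟨fun s t h => by rwa [symmDiff_comm]⟩
  loopless := ⟨fun s h => by simp at h⟩

/-- The family `M` is a 1-factorization of `H`: every `M i` is a perfect matching of `H`, and every
edge of `H` lies in exactly one `M i`. -/
def IsOneFactorization {V ι : Type*} {H : SimpleGraph V} (M : ι → H.Subgraph) : Prop :=
  (∀ i, (M i).IsPerfectMatching) ∧ ∀ e ∈ H.edgeSet, ∃! i, e ∈ (M i).edgeSet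

/-- The subgraph `F` of `H` is a Hamilton cycle of `H`: it consists of exactly the vertices and
edges traversed by some closed walk that is a Hamiltonian cycle. -/
def IsHamiltonCycleSubgraph {V : Type*} [DecidableEq V] {H : SimpleGraph V}
    (F : H.Subgraph) : Prop :=
  ∃ (v : V) (p : H.Walk v v), p.IsHamiltonianCycle ∧ p.toSubgraph = F

/-- The graph `G[M]` on the indices of the factors: distinct `i`, `j` are adjacent when
`M i ∪ M j` is a Hamilton cycle. -/
def hamiltonPairGraph {V ι : Type*} [DecidableEq V] {H : SimpleGraph V}
    (M : ι → H.Subgraph) : SimpleGraph ι where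
  Adj i j := i ≠ j ∧ IsHamiltonCycleSubgraph (M i ⊔ M j)
  symm := ⟨fun i j h => ⟨h.1.symm, by rw [sup_comm]; exact h.2⟩⟩
  loopless := ⟨fun _ h => h.1 rfl⟩

/-- The subgraph `F` of `Q_d` only uses edges in directions from `S`, where an edge `st` is in
direction `i` when `s` and `t` differ in the element `i`. -/
def UsesOnlyDirections {d : ℕ} (F : (hypercube d).Subgraph) (S : Set (Fin d)) : Prop :=
  ∀ s t, F.Adj s t → ∀ i ∈ symmDiff s t, i ∈ S

/-- The first `k` factors only use the first `k` directions and the last `l` factors only use the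
last `l` directions. -/
def IsDirectionRespecting {k l : ℕ} (M : Fin (k + l) → (hypercube (k + l)).Subgraph) : Prop :=
  (∀ i : Fin k, UsesOnlyDirections (M (Fin.castAdd l i)) (Set.range (Fin.castAdd l))) ∧
    ∀ j : Fin l, UsesOnlyDirections (M (Fin.natAdd k j)) (Set.range (Fin.natAdd k))

/-! Encode a 1-factor by the fixed-point-free involution that sends a vertex to its partner. The
union of two disjoint factors is 2-regular, so it is a Hamilton cycle exactly when it is connected,
that is, when the involutions are `JointlyTransitive`. In a direction respecting factorization two
factors of the same side never change the coordinates of the other side, so `G[M]` always lies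
inside `K_{k,l}`. Counting edges, it is isomorphic to `K_{k,l}` iff every left factor is connected
with every right one. Splitting the cube as `Q_k □ Q_l` turns this into `HasCrossing`.

Existence rests on one parity fact, `eq_of_invariant_of_eq_off`: sets invariant under two
fixed-point-free involutions cannot differ in a single point. Suppose `Q_k` and `Q_l` each have a
connected pair, that is, two 1-factorizations whose equally indexed factors have connected union.
Use the first factorization of `Q_k` in one layer and the second in all others, and let the columns
alternate between the two factorizations of `Q_l` by parity. Parity carries invariance across the
special layer, so this is a crossing. A crossing with `k = l` is itself a connected pair of
`Q_{2k}`, after exchanging the two sides.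

Connected pairs exist for all `n ≠ 3`. Even `n` comes from `n / 2` by doubling, except that `6` is
given by a table. Odd `n ≥ 5` comes from a seed in dimension 5 and a step `n → n + 2` that
multiplies by a 4-cycle. In that step a distinguished color is paired with a column color, while any
other color would stay inside the four layers. Such a color is therefore joined across layers by
trading the copies of a chord for the column edges over its ends. The seed axioms ensure that the
damaged column color stays connected and that the step can be repeated. The unpaired color `solo`
has two chords and needs the extra sets `W`, `P`, `T`. If one side has dimension 3 and the other is
neither 1 nor 3, `eq_of_cube_invariant` gives a separate crossing.

Nonexistence is a sign argument. Two matchings of a bipartite graph compose to a permutation of one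
class; if their union is a Hamilton cycle and the class is even, this is a cycle of even length and
hence odd. So each left factor has the sign opposite to each right factor. The three factors along a
`Q_3` side have sign product 1, so all of them are `+` and every factor on the other side is `-`.
For `l = 1` and `l = 3` the product on that side is also 1, contradicting that `l` is odd. -/

/-! ### Connectedness of a union of two matchings -/

/-- Two self-maps act jointly transitively: every Boolean function invariant under both is
constant. For two involutions this says that the union of the two matchings is connected. -/
def JointlyTransitive {V : Type*} (s t : V → V) : Prop :=
  ∀ φ : V → Bool, (∀ v, φ (s v) = φ v) → (∀ v, φ (t v) = φ v) → ∀ v w, φ v = φ w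

theorem JointlyTransitive.symm {V : Type*} {s t : V → V} (h : JointlyTransitive s t) :
    JointlyTransitive t s := fun φ ht hs => h φ hs ht

theorem JointlyTransitive.conj {V W : Type*} {s t : V → V} (e : V ≃ W) {s' t' : W → W}
    (hs : ∀ v, s' (e v) = e (s v)) (ht : ∀ v, t' (e v) = e (t v))
    (h : JointlyTransitive s t) : JointlyTransitive s' t' := by
  intro φ h1 h2 v w
  have := h (φ ∘ e) (fun v => by simp [← hs, h1]) (fun v => by simp [← ht, h2])
    (e.symm v) (e.symm w)
  simpa using this

/-- A fixed-point-free involution leaves only subsets of even size invariant. -/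
theorem sum_eq_zero_of_involution {V : Type*} [Fintype V] {s : V → V}
    (hs : ∀ v, s (s v) = v) (hne : ∀ v, s v ≠ v) {f : V → Bool} (hf : ∀ v, f (s v) = f v) :
    ∑ v, (if f v then (1 : ZMod 2) else 0) = 0 := by
  refine Finset.sum_involution (fun v _ => s v) ?_ (fun v _ _ => hne v) (fun _ _ => Finset.mem_univ _)
    (fun v _ => hs v)
  intro v _
  rw [hf]
  exact CharTwo.add_self_eq_zero _

/-- Both invariant sets have even size, so their sizes off `v₀` determine the values at `v₀`. -/
theorem eq_of_invariant_of_eq_off {V : Type*} [Finite V] {s t : V → V}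
    (hs : ∀ v, s (s v) = v) (hs' : ∀ v, s v ≠ v) (ht : ∀ v, t (t v) = v) (ht' : ∀ v, t v ≠ v)
    {f g : V → Bool} (hf : ∀ v, f (s v) = f v) (hg : ∀ v, g (t v) = g v) (v₀ : V)
    (h : ∀ v, v ≠ v₀ → f v = g v) : f = g := by
  classical
  have := Fintype.ofFinite V
  have h1 := sum_eq_zero_of_involution hs hs' hf
  have h2 := sum_eq_zero_of_involution ht ht' hg
  rw [← Finset.add_sum_erase _ _ (Finset.mem_univ v₀)] at h1 h2
  have h3 : ∑ v ∈ Finset.univ.erase v₀, (if f v then (1 : ZMod 2) else 0) =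
      ∑ v ∈ Finset.univ.erase v₀, (if g v then (1 : ZMod 2) else 0) :=
    Finset.sum_congr rfl fun v hv => by rw [h v (Finset.ne_of_mem_erase hv)]
  have h4 := add_right_cancel ((h3 ▸ h1).trans h2.symm)
  funext v
  by_cases hv : v = v₀
  · subst hv
    revert h4
    cases f v <;> cases g v <;> simp
  · exact h v hv

/-- An invariant function of one involution that is invariant under another one except along a
single edge is invariant along that edge too. -/
theorem eq_along_exceptional_edge {V : Type*} [Finite V] {s t : V → V}
    (hs : ∀ v, s (s v) = v) (hs' : ∀ v, s v ≠ v) (ht : ∀ v, t (t v) = v) (ht' : ∀ v, t v ≠ v)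
    {f : V → Bool} (hf : ∀ v, f (t v) = f v) {u w : V} (huw : s u = w)
    (h : ∀ v, v ≠ u → v ≠ w → f (s v) = f v) : f u = f w := by
  classical
  have hwu : s w = u := by rw [← huw, hs]
  have hne : u ≠ w := fun e => hs' u (huw.trans e.symm)
  -- Overwriting the value at `w` by the one at `u` makes `f` invariant under `s`. The result
  -- differs from the `t`-invariant `f` at most at `w`, so parity applies.
  have key := eq_of_invariant_of_eq_off ht ht' hs hs' (g := Function.update f w (f u)) hf (by
    intro v
    by_cases h1 : v = u
    · subst h1; rw [huw, Function.update_self, Function.update_of_ne hne]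
    by_cases h2 : v = w
    · subst h2; rw [hwu, Function.update_self, Function.update_of_ne hne]
    have h3 : s v ≠ w := fun e => h1 (by rw [← hs v, e, hwu])
    rw [Function.update_of_ne h3, Function.update_of_ne h2, h v h1 h2]) w
    (fun v hv => by rw [Function.update_of_ne hv])
  have := congrFun key w
  rw [Function.update_self] at this
  exact this.symm

/-- The version of `eq_along_exceptional_edge` with two exceptional edges. -/
theorem xor_eq_along_exceptional_edges {V : Type*} [Finite V] {s t : V → V}
    (hs : ∀ v, s (s v) = v) (hs' : ∀ v, s v ≠ v) (ht : ∀ v, t (t v) = v) (ht' : ∀ v, t v ≠ v)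
    {f : V → Bool} (hf : ∀ v, f (t v) = f v) {u w u' w' : V} (huw : s u = w) (huw' : s u' = w')
    (h : ∀ v, v ≠ u → v ≠ w → v ≠ u' → v ≠ w' → f (s v) = f v) :
    (f u = f w ↔ f u' = f w') := by
  have hwu : s w = u := by rw [← huw, hs]
  have hwu' : s w' = u' := by rw [← huw', hs]
  constructor
  · intro e
    refine eq_along_exceptional_edge hs hs' ht ht' hf huw' fun v h1 h2 => ?_
    by_cases h3 : v = u
    · subst h3; rw [huw, e]
    by_cases h4 : v = w
    · subst h4; rw [hwu, e]
    exact h v h3 h4 h1 h2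
  · intro e
    refine eq_along_exceptional_edge hs hs' ht ht' hf huw fun v h1 h2 => ?_
    by_cases h3 : v = u'
    · subst h3; rw [huw', e]
    by_cases h4 : v = w'
    · subst h4; rw [hwu', e]
    exact h v h1 h2 h3 h4

/-! ### 1-factorizations as colorings by involutions -/

/-- `f` is a 1-factorization of `G`: `f c` sends a vertex to its partner in the matching `c`. -/
structure IsFactoring {V C : Type*} (G : SimpleGraph V) (f : C → V → V) : Prop where
  invol : ∀ c v, f c (f c v) = v
  adj_iff : ∀ v w, G.Adj v w ↔ ∃ c, f c v = w
  inj : ∀ c d v, f c v = f d v → c = d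

namespace IsFactoring

variable {V W C D : Type*} {G : SimpleGraph V} {H : SimpleGraph W} {f : C → V → V}

theorem adj (hf : IsFactoring G f) (c : C) (v : V) : G.Adj v (f c v) := (hf.adj_iff _ _).2 ⟨c, rfl⟩

theorem ne (hf : IsFactoring G f) (c : C) (v : V) : f c v ≠ v := (hf.adj c v).ne'

theorem reindex (hf : IsFactoring G f) (e : D ≃ C) : IsFactoring G (fun d => f (e d)) where
  invol _ _ := hf.invol _ _
  adj_iff v w := by rw [hf.adj_iff]; exact e.exists_congr_right.symm
  inj c d v h := e.injective (hf.inj _ _ v h)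

theorem map (hf : IsFactoring G f) (e : G ≃g H) : IsFactoring H (fun c w => e (f c (e.symm w))) where
  invol c w := by simp [hf.invol]
  adj_iff v w := by
    rw [← e.symm.map_adj_iff, hf.adj_iff]
    simp only [← e.symm_apply_eq, eq_comm]
  inj c d v h := hf.inj _ _ _ (e.injective h)

/-- Each layer of a box product may be factored independently. -/
theorem layered {P : W → C → V → V} {U : V → D → W → W} (hP : ∀ y, IsFactoring G (P y))
    (hU : ∀ x, IsFactoring H (U x)) :
    IsFactoring (SimpleGraph.boxProd G H)
      (Sum.elim (fun c v => (P v.2 c v.1, v.2)) (fun d v => (v.1, U v.1 d v.2))) where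
  invol c v := by
    cases c with
    | inl c => simp [(hP _).invol]
    | inr d => simp [(hU _).invol]
  adj_iff v w := by
    obtain ⟨x, y⟩ := v
    obtain ⟨x', y'⟩ := w
    simp only [SimpleGraph.boxProd_adj, Sum.exists, Sum.elim_inl, Sum.elim_inr, Prod.mk.injEq]
    rw [(hP y).adj_iff, (hU x).adj_iff]
    constructor
    · rintro (⟨⟨c, h⟩, h'⟩ | ⟨⟨c, h⟩, h'⟩)
      · exact Or.inl ⟨c, h, h'⟩
      · exact Or.inr ⟨c, h', h⟩
    · rintro (⟨c, h, h'⟩ | ⟨c, h, h'⟩)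
      · exact Or.inl ⟨⟨c, h⟩, h'⟩
      · exact Or.inr ⟨⟨c, h'⟩, h⟩
  inj c d v h := by
    obtain ⟨x, y⟩ := v
    cases c with
    | inl c =>
      cases d with
      | inl d => exact congrArg _ ((hP y).inj _ _ x (congrArg Prod.fst h))
      | inr d => exact absurd (congrArg Prod.fst h) ((hP y).ne _ _)
    | inr c =>
      cases d with
      | inl d => exact absurd (congrArg Prod.fst h).symm ((hP y).ne _ _)
      | inr d => exact congrArg _ ((hU x).inj _ _ y (congrArg Prod.snd h))

/-- Colors may be permuted at each vertex, if the permutations agree along edges. -/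
theorem recolor (hf : IsFactoring G f) (π : V → Equiv.Perm C)
    (hπ : ∀ v c, π (f (π v c) v) c = π v c) : IsFactoring G (fun c v => f (π v c) v) where
  invol c v := by simp only [hπ, hf.invol]
  adj_iff v w := by rw [hf.adj_iff]; exact (π v).exists_congr_right.symm
  inj c d v h := (π v).injective (hf.inj _ _ v h)

end IsFactoring

/-! ### Pairs of factorizations and crossing factorizations -/

/-- `G` has two 1-factorizations, indexed by `C`, such that factors with equal index together form
a connected graph. -/
def HasConnectedPair {V : Type*} (G : SimpleGraph V) (C : Type*) : Prop :=
  ∃ A B : C → V → V, IsFactoring G A ∧ IsFactoring G B ∧ ∀ c, JointlyTransitive (A c) (B c)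

theorem HasConnectedPair.map {V W C : Type*} {G : SimpleGraph V} {H : SimpleGraph W} (e : G ≃g H)
    (h : HasConnectedPair G C) : HasConnectedPair H C := by
  obtain ⟨A, B, hA, hB, h⟩ := h
  exact ⟨_, _, hA.map e, hB.map e, fun c => (h c).conj e.toEquiv (by simp) (by simp)⟩

theorem HasConnectedPair.reindex {V C D : Type*} {G : SimpleGraph V} (e : D ≃ C)
    (h : HasConnectedPair G C) : HasConnectedPair G D := by
  obtain ⟨A, B, hA, hB, h⟩ := h
  exact ⟨_, _, hA.reindex e, hB.reindex e, fun c => h (e c)⟩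

/-- `P` factors the layers of `G □ H` parallel to `G`, `U` those parallel to `H`, and any factor of
the first kind forms a connected graph with any factor of the second kind. -/
structure IsCrossing {V W C D : Type*} (G : SimpleGraph V) (H : SimpleGraph W)
    (P : W → C → V → V) (U : V → D → W → W) : Prop where
  left : ∀ y, IsFactoring G (P y)
  right : ∀ x, IsFactoring H (U x)
  trans : ∀ c d, JointlyTransitive (fun v : V × W => (P v.2 c v.1, v.2))
    (fun v : V × W => (v.1, U v.1 d v.2))

/-- The box product of `G` and `H` has a 1-factorization into `C` factors parallel to `G` and `D`
factors parallel to `H` such that any two factors of different kind form a connected graph. -/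
def HasCrossing {V W : Type*} (G : SimpleGraph V) (H : SimpleGraph W) (C D : Type*) : Prop :=
  ∃ (P : W → C → V → V) (U : V → D → W → W), IsCrossing G H P U

theorem HasCrossing.symm {V W C D : Type*} {G : SimpleGraph V} {H : SimpleGraph W}
    (h : HasCrossing G H C D) : HasCrossing H G D C := by
  obtain ⟨P, U, h⟩ := h
  exact ⟨U, P, h.right, h.left, fun d c => (h.trans c d).symm.conj (Equiv.prodComm V W)
    (fun _ => rfl) (fun _ => rfl)⟩

theorem HasCrossing.map {V W V' W' C D : Type*} {G : SimpleGraph V} {H : SimpleGraph W}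
    {G' : SimpleGraph V'} {H' : SimpleGraph W'} (e : G ≃g G') (e' : H ≃g H')
    (h : HasCrossing G H C D) : HasCrossing G' H' C D := by
  obtain ⟨P, U, h⟩ := h
  exact ⟨_, _, fun y => (h.left (e'.symm y)).map e, fun x => (h.right (e.symm x)).map e',
    fun c d => (h.trans c d).conj (Equiv.prodCongr e.toEquiv e'.toEquiv) (by simp) (by simp)⟩

/-- A crossing factorization with as many factors of each kind gives a connected pair, by
exchanging the two kinds. -/
theorem HasCrossing.hasConnectedPair {V W C : Type*} {G : SimpleGraph V} {H : SimpleGraph W}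
    (h : HasCrossing G H C C) : HasConnectedPair (SimpleGraph.boxProd G H) (C ⊕ C) := by
  obtain ⟨P, U, h⟩ := h
  have hF := IsFactoring.layered h.left h.right
  refine ⟨_, _, hF, hF.reindex (Equiv.sumComm C C), ?_⟩
  rintro (c | c)
  · exact h.trans c c
  · exact (h.trans c c).symm

/-- The two-coordinate connectedness argument: columns over the ends of an edge `x – P' x` carry
two matchings that are jointly transitive, and the horizontal matching is `P'` in all layers
but one. -/
theorem constant_of_special_layer {V W : Type*} [Finite W] {P' P₀ : V → V} {U : V → W → W}
    (hU : ∀ x y, U x (U x y) = y) (hU' : ∀ x y, U x y ≠ y) (y₀ : W)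
    (hUU : ∀ x, JointlyTransitive (U x) (U (P' x))) (hP : JointlyTransitive P' P₀)
    {φ : V × W → Bool} (h1 : ∀ x y, y ≠ y₀ → φ (P' x, y) = φ (x, y))
    (h0 : ∀ x, φ (P₀ x, y₀) = φ (x, y₀)) (h2 : ∀ x y, φ (x, U x y) = φ (x, y)) :
    ∀ v w, φ v = φ w := by
  -- The columns over `x` and `P' x` carry different matchings, but their invariant functions agree
  -- off `y₀`. By parity they agree at `y₀` too, and each becomes invariant under both matchings.
  have e1 : ∀ x y, φ (P' x, y) = φ (x, y) := fun x => congrFun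
    (eq_of_invariant_of_eq_off (hU _) (hU' _) (hU _) (hU' _) (h2 (P' x)) (h2 x) y₀ (h1 x))
  have e2 : ∀ x y y', φ (x, y) = φ (x, y') := fun x =>
    hUU x (fun y => φ (x, y)) (h2 x) fun y => by
      have := h2 (P' x) y
      rwa [e1, e1] at this
  rintro ⟨x, y⟩ ⟨x', y'⟩
  rw [e2 x y y₀, e2 x' y' y₀]
  exact hP (fun x => φ (x, y₀)) (fun x => e1 x y₀) h0 x x'

/-- The product construction: two graphs with connected pairs have a crossing factorization. -/
theorem HasConnectedPair.hasCrossing {V W C D : Type*} [Finite W] [Nonempty W] {G : SimpleGraph V}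
    {H : SimpleGraph W} (par : V → Bool) (hpar : ∀ v w, G.Adj v w → par w = !par v)
    (hG : HasConnectedPair G C) (hH : HasConnectedPair H D) : HasCrossing G H C D := by
  classical
  obtain ⟨P, P', hP, hP', hPP⟩ := hG
  obtain ⟨U, U', hU, hU', hUU⟩ := hH
  obtain ⟨y₀⟩ := ‹Nonempty W›
  refine ⟨fun y => if y = y₀ then P else P', fun x => if par x then U else U', fun y => ?_,
    fun x => ?_, fun c d => ?_⟩
  · split_ifs <;> assumption
  · split_ifs <;> assumption
  · have hR : ∀ x, IsFactoring H (if par x then U else U') := fun x => by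
      split_ifs <;> assumption
    intro φ h1 h2
    refine constant_of_special_layer (P' := P' c) (P₀ := P c)
      (U := fun x => (if par x then U else U') d) (fun x y => (hR x).invol _ _)
      (fun x y => (hR x).ne _ _) y₀ (fun x => ?_) (hPP c).symm (fun x y hy => ?_) (fun x => ?_)
      (fun x y => h2 (x, y))
    · rw [hpar _ _ (hP'.adj c x)]
      cases par x
      · simpa using (hUU d).symm
      · simpa using hUU d
    · simpa [hy] using h1 (x, y)
    · simpa using h1 (x, y₀)

/-! ### Hypercubes -/

theorem hypercube_adj_iff {d : ℕ} (s t : Finset (Fin d)) :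
    (hypercube d).Adj s t ↔ ∃ i, symmDiff s {i} = t := by
  change (symmDiff s t).card = 1 ↔ _
  rw [Finset.card_eq_one]
  refine exists_congr fun i => ?_
  rw [eq_comm, ← symmDiff_right_inj (a := s), symmDiff_symmDiff_cancel_left]

/-- The parity class of a vertex of the hypercube. -/
def hypercubeParity {d : ℕ} (s : Finset (Fin d)) : Bool := decide (Odd s.card)

theorem hypercubeParity_of_adj {d : ℕ} (s t : Finset (Fin d)) (h : (hypercube d).Adj s t) :
    hypercubeParity t = !hypercubeParity s := by
  obtain ⟨i, rfl⟩ := (hypercube_adj_iff s t).1 h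
  unfold hypercubeParity
  by_cases hi : i ∈ s
  · have : symmDiff s {i} = s.erase i := by
      ext j; simp [Finset.mem_symmDiff]; grind
    rw [this]
    have := Finset.card_erase_add_one hi
    rw [← this]
    simp [Nat.odd_add_one, -Nat.not_odd_iff_even]
  · have : symmDiff s {i} = insert i s := by
      ext j; simp [Finset.mem_symmDiff]; grind
    rw [this, Finset.card_insert_of_notMem hi]
    simp [Nat.odd_add_one, -Nat.not_odd_iff_even]

/-- The graph in which the neighbors of `v` are the vertices `flip i v`. -/
def flipGraph {V ι : Type*} (flip : ι → V → V) (hne : ∀ i v, flip i v ≠ v)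
    (hinv : ∀ i v, flip i (flip i v) = v) : SimpleGraph V where
  Adj v w := ∃ i, flip i v = w
  symm := ⟨fun v w ⟨i, h⟩ => ⟨i, by rw [← h, hinv]⟩⟩
  loopless := ⟨fun v ⟨i, h⟩ => hne i v h⟩

theorem flipGraph_isFactoring {V ι : Type*} {flip : ι → V → V} {hne : ∀ i v, flip i v ≠ v}
    {hinv : ∀ i v, flip i (flip i v) = v} (hinj : ∀ i j v, flip i v = flip j v → i = j) :
    IsFactoring (flipGraph flip hne hinv) flip where
  invol := hinv
  adj_iff _ _ := Iff.rfl
  inj := hinj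

/-- A flip graph whose flips correspond to toggling single elements is a hypercube. -/
def flipGraphIso {V : Type*} {d : ℕ} (flip : Fin d → V → V) (hne : ∀ i v, flip i v ≠ v)
    (hinv : ∀ i v, flip i (flip i v) = v) (e : V ≃ Finset (Fin d))
    (he : ∀ i v, e (flip i v) = symmDiff (e v) {i}) :
    flipGraph flip hne hinv ≃g hypercube d where
  toEquiv := e
  map_rel_iff' := by
    intro v w
    rw [hypercube_adj_iff]
    exact exists_congr fun i => by rw [← he, e.apply_eq_iff_eq]

/-- A subset of `Fin (k + l)` is a pair of subsets of `Fin k` and `Fin l`. -/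
def finsetFinSumEquiv (k l : ℕ) : Finset (Fin k) × Finset (Fin l) ≃ Finset (Fin (k + l)) :=
  Finset.sumEquiv.symm.toEquiv.trans finSumFinEquiv.finsetCongr

@[simp] theorem castAdd_mem_finsetFinSumEquiv {k l : ℕ} (v : Finset (Fin k) × Finset (Fin l))
    (i : Fin k) : Fin.castAdd l i ∈ finsetFinSumEquiv k l v ↔ i ∈ v.1 := by
  obtain ⟨s, t⟩ := v
  simp [finsetFinSumEquiv, Finset.sumEquiv, finSumFinEquiv]

@[simp] theorem natAdd_mem_finsetFinSumEquiv {k l : ℕ} (v : Finset (Fin k) × Finset (Fin l))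
    (j : Fin l) : Fin.natAdd k j ∈ finsetFinSumEquiv k l v ↔ j ∈ v.2 := by
  obtain ⟨s, t⟩ := v
  simp [finsetFinSumEquiv, Finset.sumEquiv, finSumFinEquiv]

theorem finsetFinSumEquiv_symmDiff_left {k l : ℕ} (s : Finset (Fin k)) (t : Finset (Fin l))
    (i : Fin k) : finsetFinSumEquiv k l (symmDiff s {i}, t) =
      symmDiff (finsetFinSumEquiv k l (s, t)) {Fin.castAdd l i} := by
  ext j
  refine Fin.addCases (fun j => ?_) (fun j => ?_) j <;>
    (simp [Finset.mem_symmDiff, Fin.ext_iff]; try grind)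

theorem finsetFinSumEquiv_symmDiff_right {k l : ℕ} (s : Finset (Fin k)) (t : Finset (Fin l))
    (i : Fin l) : finsetFinSumEquiv k l (s, symmDiff t {i}) =
      symmDiff (finsetFinSumEquiv k l (s, t)) {Fin.natAdd k i} := by
  ext j
  refine Fin.addCases (fun j => ?_) (fun j => ?_) j <;>
    (simp [Finset.mem_symmDiff, Fin.ext_iff]; try grind)

/-- The box product of two hypercubes is a hypercube. -/
def hypercubeSumIso (k l : ℕ) :
    SimpleGraph.boxProd (hypercube k) (hypercube l) ≃g hypercube (k + l) where
  toEquiv := finsetFinSumEquiv k l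
  map_rel_iff' := by
    rintro ⟨s, t⟩ ⟨s', t'⟩
    rw [hypercube_adj_iff, SimpleGraph.boxProd_adj, hypercube_adj_iff, hypercube_adj_iff]
    constructor
    · rintro ⟨i, h⟩
      revert h
      refine Fin.addCases (fun i h => ?_) (fun i h => ?_) i
      · rw [← finsetFinSumEquiv_symmDiff_left, (finsetFinSumEquiv k l).apply_eq_iff_eq,
          Prod.mk.injEq] at h
        exact Or.inl ⟨⟨i, h.1⟩, h.2⟩
      · rw [← finsetFinSumEquiv_symmDiff_right, (finsetFinSumEquiv k l).apply_eq_iff_eq,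
          Prod.mk.injEq] at h
        exact Or.inr ⟨⟨i, h.2⟩, h.1⟩
    · rintro (⟨⟨i, h⟩, h'⟩ | ⟨⟨i, h⟩, h'⟩)
      · exact ⟨Fin.castAdd l i, by rw [← finsetFinSumEquiv_symmDiff_left]; simp_all⟩
      · exact ⟨Fin.natAdd k i, by rw [← finsetFinSumEquiv_symmDiff_right]; simp_all⟩

/-- Box products respect isomorphisms. -/
def boxProdIso {V W V' W' : Type*} {G : SimpleGraph V} {H : SimpleGraph W}
    {G' : SimpleGraph V'} {H' : SimpleGraph W'} (e : G ≃g G') (e' : H ≃g H') :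
    SimpleGraph.boxProd G H ≃g SimpleGraph.boxProd G' H' where
  toEquiv := Equiv.prodCongr e.toEquiv e'.toEquiv
  map_rel_iff' := by
    rintro ⟨s, t⟩ ⟨s', t'⟩
    exact or_congr (and_congr e.map_adj_iff e'.injective.eq_iff)
      (and_congr e'.map_adj_iff e.injective.eq_iff)

/-- The hypercube `Q_n` has two 1-factorizations with corresponding factors forming connected
unions. -/
def HypercubePair (n : ℕ) : Prop := HasConnectedPair (hypercube n) (Fin n)

theorem HypercubePair.of_iso {V C : Type*} {G : SimpleGraph V} [Fintype C] {n : ℕ}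
    (h : HasConnectedPair G C) (e : G ≃g hypercube n) (hC : Fintype.card C = n) :
    HypercubePair n :=
  (h.map e).reindex (Fintype.equivFinOfCardEq hC).symm

theorem HypercubePair.hasCrossing {k l : ℕ} (hk : HypercubePair k) (hl : HypercubePair l) :
    HasCrossing (hypercube k) (hypercube l) (Fin k) (Fin l) :=
  HasConnectedPair.hasCrossing hypercubeParity hypercubeParity_of_adj hk hl

theorem HypercubePair.double {k : ℕ} (hk : HypercubePair k) : HypercubePair (k + k) :=
  .of_iso (hk.hasCrossing hk).hasConnectedPair (hypercubeSumIso k k) (by simp)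

/-! ### Verification by computation -/

/-- The vertices met when walking `n` double steps from `v`, alternating between `s` and `t`. -/
def alternatingWalk {V : Type*} (s t : V → V) : ℕ → V → List V
  | 0, _ => []
  | n + 1, v => v :: s v :: alternatingWalk s t n (t (s v))

theorem eq_of_mem_alternatingWalk {V : Type*} {s t : V → V} {φ : V → Bool}
    (hs : ∀ v, φ (s v) = φ v) (ht : ∀ v, φ (t v) = φ v) (n : ℕ) (v w : V)
    (h : w ∈ alternatingWalk s t n v) : φ w = φ v := by
  induction n generalizing v with
  | zero => simp [alternatingWalk] at h
  | succ n ih =>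
    simp only [alternatingWalk, List.mem_cons] at h
    rcases h with rfl | rfl | h
    · rfl
    · exact hs v
    · rw [ih _ h, ht, hs]

theorem jointlyTransitive_of_alternatingWalk {V : Type*} {s t : V → V} (n : ℕ) (v : V)
    (h : ∀ w, w ∈ alternatingWalk s t n v) : JointlyTransitive s t := fun _ hs ht x y =>
  (eq_of_mem_alternatingWalk hs ht n v x (h x)).trans
    (eq_of_mem_alternatingWalk hs ht n v y (h y)).symm

/-! ### Seeds: the inductive structure behind connected pairs in odd dimension -/

/-- The factors of a seed: two distinguished ones, an unpaired one, and pairs indexed by `R`. -/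
inductive SeedColor (R : Type) : Type
  | one | two | solo
  | left (r : R)
  | right (r : R)

namespace SeedColor

variable {R : Type}

/-- Exchange the two distinguished factors. -/
def swap : SeedColor R → SeedColor R
  | one => two
  | two => one
  | x => x

theorem swap_swap (x : SeedColor R) : x.swap.swap = x := by cases x <;> rfl

/-- `swap` as an equivalence. -/
def swapEquiv : SeedColor R ≃ SeedColor R := ⟨swap, swap, swap_swap, swap_swap⟩

@[simp] theorem swapEquiv_apply (x : SeedColor R) : swapEquiv x = x.swap := rfl

/-- The first chord color of a site. The site `some none` is a spare one. -/
def fst : Option (Option R) → SeedColor R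
  | none => solo
  | some none => one
  | some (some r) => left r

/-- The second chord color of a site. -/
def snd : Option (Option R) → SeedColor R
  | none => solo
  | some none => two
  | some (some r) => right r

/-- The number of colors. -/
def equivSum : SeedColor R ≃ (Fin 3 ⊕ R ⊕ R) where
  toFun
    | one => .inl 0
    | two => .inl 1
    | solo => .inl 2
    | left r => .inr (.inl r)
    | right r => .inr (.inr r)
  invFun
    | .inl 0 => one
    | .inl 1 => two
    | .inl 2 => solo
    | .inr (.inl r) => left r
    | .inr (.inr r) => right r
  left_inv x := by cases x <;> rfl
  right_inv x := by
    rcases x with x | r | r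
    · fin_cases x <;> rfl
    · rfl
    · rfl

instance [DecidableEq R] : DecidableEq (SeedColor R) := equivSum.decidableEq

instance [Fintype R] : Fintype (SeedColor R) := Fintype.ofEquiv _ equivSum.symm

theorem card_eq [Fintype R] : Fintype.card (SeedColor R) = 2 * Fintype.card R + 3 := by
  rw [Fintype.card_congr equivSum]
  simp
  ring

/-- How the colors of the next seed arise in its first factorization. -/
def nextLeft : SeedColor (Option R) ≃ SeedColor R ⊕ Bool where
  toFun
    | one => .inr true
    | two => .inl one
    | solo => .inl solo
    | left none => .inr false
    | right none => .inl two
    | left (some r) => .inl (left r)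
    | right (some r) => .inl (right r)
  invFun
    | .inr true => one
    | .inl one => two
    | .inl solo => solo
    | .inr false => left none
    | .inl two => right none
    | .inl (left r) => left (some r)
    | .inl (right r) => right (some r)
  left_inv x := by rcases x with _ | _ | _ | (_ | _) | (_ | _) <;> rfl
  right_inv x := by rcases x with (_ | _ | _ | _ | _) | (_ | _) <;> rfl

/-- How the colors of the next seed arise in its second factorization. -/
def nextRight : SeedColor (Option R) ≃ SeedColor R ⊕ Bool where
  toFun
    | one => .inl two
    | two => .inr true
    | solo => .inl solo
    | left none => .inl one
    | right none => .inr false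
    | left (some r) => .inl (left r)
    | right (some r) => .inl (right r)
  invFun
    | .inl two => one
    | .inr true => two
    | .inl solo => solo
    | .inl one => left none
    | .inr false => right none
    | .inl (left r) => left (some r)
    | .inl (right r) => right (some r)
  left_inv x := by rcases x with _ | _ | _ | (_ | _) | (_ | _) <;> rfl
  right_inv x := by rcases x with (_ | _ | _ | _ | _) | (_ | _) <;> rfl

end SeedColor

/-! ### Seeds: data, chords and axioms -/

open SeedColor in
/-- The factorizations of a seed, together with the base vertex of each site. -/
structure SeedData (V R : Type) where
  /-- the bipartition -/
  par : V → Bool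
  /-- the first factorization -/
  Z : SeedColor R → V → V
  /-- the second factorization -/
  Y : SeedColor R → V → V
  /-- a variant of the second factorization -/
  Y' : SeedColor R → V → V
  /-- the base vertices; `a (some none)` is the spare one -/
  a : Option (Option R) → V
  /-- an orbit of the unpaired factors of the first and third factorization -/
  W : V → Bool
  /-- an invariant set of the unpaired factors of the first two, up to the chords -/
  P : V → Bool
  /-- another such set, with one more exceptional edge -/
  T : V → Bool

namespace SeedData

open SeedColor

variable {V R : Type} (S : SeedData V R)

/-- The first vertex of the second chord. -/
def d (i : Option (Option R)) : V := S.Y one (S.a i)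
/-- The vertex between the two chords. -/
def d₂ (i : Option (Option R)) : V := S.Y two (S.d i)
/-- The other end of the first chord. -/
def b (i : Option (Option R)) : V := S.Y one (S.d₂ i)
/-- The other end of the second chord. -/
def D (i : Option (Option R)) : V := S.Z (snd i) (S.d i)
/-- The vertex before `a`. -/
def a₀ (i : Option (Option R)) : V := S.Y two (S.a i)
/-- The partner of `a₀` in the second chord color. -/
def E (i : Option (Option R)) : V := S.Z (snd i) (S.a₀ i)
/-- The partner of `a` in the second chord color. -/
def F (i : Option (Option R)) : V := S.Z (snd i) (S.a i)

/-- `x` is the end of a chord of color `k`. -/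
def IsChordEnd (x : V) (k : SeedColor R) : Prop :=
  ∃ i ≠ some none, ((x = S.a i ∨ x = S.b i) ∧ k = fst i) ∨ ((x = S.d i ∨ x = S.D i) ∧ k = snd i)

/-- `x` is not the end of a chord. -/
def OffChords (x : V) : Prop := ∀ k, ¬ S.IsChordEnd x k

/-- The axioms of a seed. -/
structure IsSeed (G : SimpleGraph V) : Prop where
  par_adj : ∀ v w, G.Adj v w → S.par w = !S.par v
  factoring_Z : IsFactoring G S.Z
  factoring_Y : IsFactoring G S.Y
  factoring_Y' : IsFactoring G S.Y'
  trans_ZY : ∀ x, JointlyTransitive (S.Z x) (S.Y x)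
  -- The next `Y` uses `Y'` in layer `0`, so a paired color must be connected there too. For `solo`
  -- this fails: `Z` and `Y'` leave the two orbits given by `W`.
  trans_left : ∀ r, JointlyTransitive (S.Z (left r)) (S.Y' (left r))
  trans_right : ∀ r, JointlyTransitive (S.Z (right r)) (S.Y' (right r))
  -- In the next factorizations a distinguished color is one factor in the special layer and another
  -- in the remaining layers; these axioms connect the two.
  trans_ZZ : JointlyTransitive (S.Z one) (S.Z two)
  trans_YY : JointlyTransitive (S.Y one) (S.Y two)
  trans_Y'Y : JointlyTransitive (S.Y' one) (S.Y two)
  Y'_two : ∀ x, S.Y' two x = S.Y two x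
  par_a : ∀ i, S.par (S.a i) = false
  -- `a`, `d`, `d₂`, `b` is a path alternating between `Y one` and `Y two`, and the first chord
  -- closes it to a 4-cycle.
  chord : ∀ i ≠ some none, S.Z (fst i) (S.a i) = S.b i
  chordEnd_unique : ∀ x k k', S.IsChordEnd x k → S.IsChordEnd x k' → k = k'
  -- Vertices next to the chords avoid all chords, so their column edges survive in the column
  -- color; `trans_chords` starts from them.
  off_a₀ : ∀ i ≠ some none, S.OffChords (S.a₀ i)
  off_b₀ : ∀ i ≠ some none, S.OffChords (S.Y two (S.b i))
  off_d₂ : ∀ i ≠ some none, S.OffChords (S.d₂ i)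
  off_YD : ∀ i ≠ some none, ∀ k, k = one ∨ k = two → S.OffChords (S.Y k (S.D i))
  off_spare : S.OffChords (S.a (some none))
  -- The next chord ends lie over the vertices `a`, `a₀` and `E`; `a_inj`, `E_inj` and `E_ne_a` keep
  -- them apart, and `F_inj` passes `E_inj` on.
  a_inj : ∀ i j, S.a i = S.a j → i = j
  E_inj : ∀ i j, S.E i = S.E j → i = j
  E_ne_a : ∀ i j, S.E i ≠ S.a j
  F_inj : ∀ i j, S.F (some i) = S.F (some j) → i = j
  -- `Z solo` and `Y' solo` have exactly the orbits `W` and its complement, with one solo chord in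
  -- each.
  W_Z : ∀ x, S.W (S.Z solo x) = S.W x
  W_Y' : ∀ x, S.W (S.Y' solo x) = S.W x
  W_a : S.W (S.a none) = true
  W_d : S.W (S.d none) = false
  W_orbit : ∀ φ : V → Bool, (∀ x, φ (S.Z solo x) = φ x) → (∀ x, φ (S.Y' solo x) = φ x) →
    ∀ x y, S.W x = S.W y → φ x = φ y
  -- Without the two chords, the cycle of `Z solo` and `Y solo` falls into two paths, from `a` to
  -- `d` and from `b` to `D`. `P` is the first path.
  P_Y : ∀ x, S.P (S.Y solo x) = S.P x
  P_Z : ∀ x, ¬ S.IsChordEnd x solo → S.P (S.Z solo x) = S.P x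
  P_a : S.P (S.a none) = true
  P_d : S.P (S.d none) = true
  P_b : S.P (S.b none) = false
  P_D : S.P (S.D none) = false
  P_a₀ : S.P (S.a₀ none) = false
  -- Removing the edge `a₀`–`E` as well cuts the second path; `T` marks the piece with `D` and `a₀`.
  -- The values of `T` on `P` play no role.
  T_Y : ∀ x, S.T (S.Y solo x) = S.T x
  T_Z : ∀ x, ¬ S.IsChordEnd x solo → x ≠ S.a₀ none → x ≠ S.E none → S.T (S.Z solo x) = S.T x
  T_D : S.T (S.D none) = true
  T_a₀ : S.T (S.a₀ none) = true
  T_b : S.T (S.b none) = false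
  T_E : S.T (S.E none) = false

end SeedData

/-! ### The 4-cycle -/

/-- The two matchings of a 4-cycle. -/
def squareFlip : Bool → Fin 4 → Fin 4
  | false => ![1, 0, 3, 2]
  | true => ![3, 2, 1, 0]

theorem squareFlip_flip (d : Bool) (z : Fin 4) : squareFlip d (squareFlip d z) = z := by
  revert d z; decide

theorem squareFlip_ne (d : Bool) (z : Fin 4) : squareFlip d z ≠ z := by
  revert d z; decide

theorem squareFlip_inj (d d' : Bool) (z : Fin 4) (h : squareFlip d z = squareFlip d' z) :
    d = d' := by
  revert d d' z; decide

/-- The 4-cycle. -/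
def square : SimpleGraph (Fin 4) := flipGraph squareFlip squareFlip_ne squareFlip_flip

theorem squareFlip_trans (d : Bool) : JointlyTransitive (squareFlip d) (squareFlip (!d)) := by
  apply jointlyTransitive_of_alternatingWalk 2 0
  revert d; decide

theorem eq_of_squareFlip_invariant {f : Fin 4 → Bool} (d : Bool)
    (h : ∀ z, f (squareFlip d z) = f z) (h' : ∀ z, f (squareFlip (!d) z) = f z) (z w : Fin 4) :
    f z = f w := squareFlip_trans d f h h' z w

/-- The 4-cycle is the two-dimensional hypercube. -/
def squareIso : square ≃g hypercube 2 where
  toEquiv := ⟨![∅, {0}, {0, 1}, {1}], fun s => if 0 ∈ s then (if 1 ∈ s then 2 else 1) else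
    (if 1 ∈ s then 3 else 0), by decide, by decide⟩
  map_rel_iff' := by
    have : ∀ a b : Fin 4, (∃ d, squareFlip d a = b) ↔ (symmDiff
      ((![∅, {0}, {0, 1}, {1}] : Fin 4 → Finset (Fin 2)) a) (![∅, {0}, {0, 1}, {1}] b)).card = 1 := by
      decide
    exact fun {a b} => (this a b).symm

/-! ### The recursion step: layers, columns and chords -/

namespace SeedData

open SeedColor

variable {V R : Type} (S : SeedData V R)

theorem isChordEnd_left (x : V) (r : R) :
    S.IsChordEnd x (left r) ↔ x = S.a (some (some r)) ∨ x = S.b (some (some r)) := by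
  constructor
  · rintro ⟨i, hi, ⟨h, h'⟩ | ⟨h, h'⟩⟩ <;> rcases i with _ | _ | i <;>
      simp_all [fst, snd]
  · exact fun h => ⟨some (some r), by simp, Or.inl ⟨h, rfl⟩⟩

theorem isChordEnd_right (x : V) (r : R) :
    S.IsChordEnd x (right r) ↔ x = S.d (some (some r)) ∨ x = S.D (some (some r)) := by
  constructor
  · rintro ⟨i, hi, ⟨h, h'⟩ | ⟨h, h'⟩⟩ <;> rcases i with _ | _ | i <;>
      simp_all [fst, snd]
  · exact fun h => ⟨some (some r), by simp, Or.inr ⟨h, rfl⟩⟩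

theorem isChordEnd_solo (x : V) : S.IsChordEnd x solo ↔
    (x = S.a none ∨ x = S.b none) ∨ (x = S.d none ∨ x = S.D none) := by
  constructor
  · rintro ⟨i, hi, ⟨h, h'⟩ | ⟨h, h'⟩⟩ <;> rcases i with _ | _ | i <;>
      simp_all [fst, snd]
  · rintro (h | h)
    · exact ⟨none, by simp, Or.inl ⟨h, rfl⟩⟩
    · exact ⟨none, by simp, Or.inr ⟨h, rfl⟩⟩

theorem IsChordEnd.ne_one {S : SeedData V R} {x : V} {k : SeedColor R} (h : S.IsChordEnd x k) :
    k ≠ one := by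
  obtain ⟨i, hi, ⟨-, h⟩ | ⟨-, h⟩⟩ := h <;> rcases i with _ | _ | i <;> simp_all [fst, snd]

theorem IsChordEnd.ne_two {S : SeedData V R} {x : V} {k : SeedColor R} (h : S.IsChordEnd x k) :
    k ≠ two := by
  obtain ⟨i, hi, ⟨-, h⟩ | ⟨-, h⟩⟩ := h <;> rcases i with _ | _ | i <;> simp_all [fst, snd]

/-- The first factorization with its distinguished factors exchanged in layer `1`. -/
def layerZ (z : Fin 4) (k : SeedColor R) : V → V := S.Z (if z = 1 then k.swap else k)

/-- The column matchings, depending on the parity of the column. -/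
def column (x : V) (d : Bool) : Fin 4 → Fin 4 := squareFlip (xor d (S.par x))

/-- Layers and columns together, before the chords are put in. -/
def layersA : SeedColor R ⊕ Bool → V × Fin 4 → V × Fin 4 :=
  Sum.elim (fun k v => (S.layerZ v.2 k v.1, v.2)) (fun d v => (v.1, S.column v.1 d v.2))

open Classical in
/-- At the ends of chords of color `k`, the colors `k` and `inr false` are exchanged. -/
noncomputable def chordPerm (x : V) : Equiv.Perm (SeedColor R ⊕ Bool) :=
  if h : ∃ k, S.IsChordEnd x k then Equiv.swap (.inr false) (.inl h.choose) else 1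

/-- The first factorization of the next seed. -/
noncomputable def nextA (c : SeedColor R ⊕ Bool) (v : V × Fin 4) : V × Fin 4 :=
  S.layersA (S.chordPerm v.1 c) v

/-- The second factorization of the next seed. Layer `0` uses `Q` with the distinguished factors
exchanged. -/
def nextB (Q : SeedColor R → V → V) : SeedColor R ⊕ Bool → V × Fin 4 → V × Fin 4 :=
  Sum.elim (fun k v => ((if v.2 = 0 then fun k => Q k.swap else S.Y) k v.1, v.2))
    (fun d v => (v.1, S.column v.1 d v.2))

/-- The graph of the next seed. -/
abbrev nextGraph (G : SimpleGraph V) : SimpleGraph (V × Fin 4) := SimpleGraph.boxProd G square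

theorem square_isFactoring (b : Bool) :
    IsFactoring square (fun d => squareFlip (xor d b)) :=
  (flipGraph_isFactoring squareFlip_inj).reindex
    (⟨fun d => xor d b, fun d => xor d b, fun d => by cases d <;> cases b <;> rfl,
      fun d => by cases d <;> cases b <;> rfl⟩ : Bool ≃ Bool)

@[simp] theorem column_column (x : V) (d : Bool) (z : Fin 4) :
    S.column x d (S.column x d z) = z := squareFlip_flip _ _

theorem column_ne (x : V) (d : Bool) (z : Fin 4) : S.column x d z ≠ z := squareFlip_ne _ _

theorem layerZ_of_ne {z : Fin 4} {k : SeedColor R} (h1 : k ≠ one) (h2 : k ≠ two) :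
    S.layerZ z k = S.Z k := by
  unfold layerZ
  split_ifs
  · cases k <;> simp_all [SeedColor.swap]
  · rfl

namespace IsSeed

variable {S} {G : SimpleGraph V} (h : S.IsSeed G)
include h

theorem par_Z (k : SeedColor R) (x : V) : S.par (S.Z k x) = !S.par x :=
  h.par_adj _ _ (h.factoring_Z.adj k x)

theorem par_Y (k : SeedColor R) (x : V) : S.par (S.Y k x) = !S.par x :=
  h.par_adj _ _ (h.factoring_Y.adj k x)

theorem par_d (i : Option (Option R)) : S.par (S.d i) = true := by
  rw [d, h.par_Y, h.par_a]; rfl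

theorem par_d₂ (i : Option (Option R)) : S.par (S.d₂ i) = false := by
  rw [d₂, h.par_Y, h.par_d]; rfl

theorem par_b (i : Option (Option R)) : S.par (S.b i) = true := by
  rw [b, h.par_Y, h.par_d₂]; rfl

theorem par_D (i : Option (Option R)) : S.par (S.D i) = false := by
  rw [D, h.par_Z, h.par_d]; rfl

theorem par_a₀ (i : Option (Option R)) : S.par (S.a₀ i) = true := by
  rw [a₀, h.par_Y, h.par_a]; rfl

theorem par_E (i : Option (Option R)) : S.par (S.E i) = false := by
  rw [E, h.par_Z, h.par_a₀]; rfl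

theorem Z_Z (k : SeedColor R) (x : V) : S.Z k (S.Z k x) = x := h.factoring_Z.invol k x

theorem Y_Y (k : SeedColor R) (x : V) : S.Y k (S.Y k x) = x := h.factoring_Y.invol k x

theorem isChordEnd_Z {x : V} {k : SeedColor R} (hx : S.IsChordEnd x k) :
    S.IsChordEnd (S.Z k x) k := by
  obtain ⟨i, hi, ⟨rfl | rfl, rfl⟩ | ⟨rfl | rfl, rfl⟩⟩ := hx
  · exact ⟨i, hi, Or.inl ⟨Or.inr (h.chord i hi), rfl⟩⟩
  · exact ⟨i, hi, Or.inl ⟨Or.inl (by rw [← h.chord i hi, h.Z_Z]), rfl⟩⟩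
  · exact ⟨i, hi, Or.inr ⟨Or.inr rfl, rfl⟩⟩
  · exact ⟨i, hi, Or.inr ⟨Or.inl (by rw [D, h.Z_Z]), rfl⟩⟩

theorem isChordEnd_Z_iff {x : V} {k : SeedColor R} :
    S.IsChordEnd (S.Z k x) k ↔ S.IsChordEnd x k :=
  ⟨fun hx => by simpa [h.Z_Z] using h.isChordEnd_Z hx, h.isChordEnd_Z⟩

theorem chordPerm_of_isChordEnd {x : V} {k : SeedColor R} (hx : S.IsChordEnd x k) :
    open Classical in S.chordPerm x = Equiv.swap (.inr false) (.inl k) := by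
  have he : ∃ k, S.IsChordEnd x k := ⟨k, hx⟩
  rw [chordPerm, dif_pos he, h.chordEnd_unique x _ _ he.choose_spec hx]

omit h in
theorem chordPerm_of_off {x : V} (hx : S.OffChords x) : S.chordPerm x = 1 :=
  dif_neg fun ⟨k, hk⟩ => hx k hk

theorem chordPerm_inl {x : V} {k : SeedColor R} (hx : ¬ S.IsChordEnd x k) :
    S.chordPerm x (.inl k) = .inl k := by
  classical
  by_cases hex : ∃ k', S.IsChordEnd x k'
  · obtain ⟨k', hk'⟩ := hex
    rw [h.chordPerm_of_isChordEnd hk', Equiv.swap_apply_of_ne_of_ne (by simp)]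
    rintro ⟨rfl⟩
    exact hx hk'
  · rw [chordPerm_of_off fun k hk => hex ⟨k, hk⟩]; rfl

theorem chordPerm_inr_true (x : V) : S.chordPerm x (.inr true) = .inr true := by
  classical
  by_cases hex : ∃ k', S.IsChordEnd x k'
  · obtain ⟨k', hk'⟩ := hex
    rw [h.chordPerm_of_isChordEnd hk', Equiv.swap_apply_of_ne_of_ne (by simp) (by simp)]
  · rw [chordPerm_of_off fun k hk => hex ⟨k, hk⟩]; rfl

theorem isChordEnd_layerZ {x : V} {k : SeedColor R} {z : Fin 4}
    (hx : S.IsChordEnd (S.layerZ z k x) k) : S.IsChordEnd x k := by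
  rw [S.layerZ_of_ne hx.ne_one hx.ne_two] at hx
  exact h.isChordEnd_Z_iff.1 hx

theorem nextA_isFactoring : IsFactoring (nextGraph G) S.nextA := by
  classical
  have hA : IsFactoring (nextGraph G) S.layersA :=
    IsFactoring.layered (P := S.layerZ) (U := S.column) (fun z => by
      unfold layerZ
      by_cases hz : z = 1
      · simpa [hz] using h.factoring_Z.reindex swapEquiv
      · simpa [hz] using h.factoring_Z) (fun x => square_isFactoring _)
  -- The copies of a chord and the column edges over its ends have the same exchange at both of
  -- their ends; every other edge has a color fixed by the permutation at both ends.
  refine hA.recolor (fun v => S.chordPerm v.1) ?_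
  rintro ⟨x, z⟩ c
  by_cases hex : ∃ k', S.IsChordEnd x k'
  · obtain ⟨k', hk'⟩ := hex
    rcases c with k | _ | _
    · by_cases hk : S.IsChordEnd x k
      · rw [h.chordPerm_of_isChordEnd hk]
        simp only [Equiv.swap_apply_right, layersA, Sum.elim_inr]
        rw [h.chordPerm_of_isChordEnd hk, Equiv.swap_apply_right]
      · simp only [h.chordPerm_inl hk, layersA, Sum.elim_inl]
        exact h.chordPerm_inl fun hk' => hk (h.isChordEnd_layerZ hk')
    · rw [h.chordPerm_of_isChordEnd hk']
      simp only [Equiv.swap_apply_left, layersA, Sum.elim_inl]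
      rw [S.layerZ_of_ne hk'.ne_one hk'.ne_two,
        h.chordPerm_of_isChordEnd (h.isChordEnd_Z hk'), Equiv.swap_apply_left]
    · simp only [h.chordPerm_inr_true]
  · rcases c with k | d
    · have hk : ¬ S.IsChordEnd x k := fun hk => hex ⟨k, hk⟩
      simp only [h.chordPerm_inl hk, layersA, Sum.elim_inl]
      exact h.chordPerm_inl fun hk' => hk (h.isChordEnd_layerZ hk')
    · simp only [chordPerm_of_off fun k hk => hex ⟨k, hk⟩, Equiv.Perm.coe_one, id, layersA,
        Sum.elim_inr]

theorem nextB_isFactoring {Q : SeedColor R → V → V} (hQ : IsFactoring G Q) :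
    IsFactoring (nextGraph G) (S.nextB Q) :=
  IsFactoring.layered (P := fun z => if z = 0 then fun k => Q k.swap else S.Y) (U := S.column)
    (fun z => by
      by_cases hz : z = 0
      · simpa [hz] using hQ.reindex swapEquiv
      · simpa [hz] using h.factoring_Y) (fun x => square_isFactoring _)

theorem nextA_inl {x : V} {k : SeedColor R} (hx : ¬ S.IsChordEnd x k) (z : Fin 4) :
    S.nextA (.inl k) (x, z) = (S.layerZ z k x, z) := by
  simp [nextA, h.chordPerm_inl hx, layersA]

theorem nextA_inl_of_ne {x : V} {k : SeedColor R} (hx : ¬ S.IsChordEnd x k) (h1 : k ≠ one)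
    (h2 : k ≠ two) (z : Fin 4) : S.nextA (.inl k) (x, z) = (S.Z k x, z) := by
  rw [h.nextA_inl hx, S.layerZ_of_ne h1 h2]

theorem nextA_inl_chord {x : V} {k : SeedColor R} (hx : S.IsChordEnd x k) (z : Fin 4) :
    S.nextA (.inl k) (x, z) = (x, S.column x false z) := by
  classical
  simp [nextA, h.chordPerm_of_isChordEnd hx, layersA]

theorem nextA_inr_true (x : V) (z : Fin 4) :
    S.nextA (.inr true) (x, z) = (x, S.column x true z) := by
  simp [nextA, h.chordPerm_inr_true, layersA]

omit h in
theorem nextA_inr_false {x : V} (hx : S.OffChords x) (z : Fin 4) :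
    S.nextA (.inr false) (x, z) = (x, S.column x false z) := by
  simp [nextA, chordPerm_of_off hx, layersA]

theorem nextA_inr_false_chord {x : V} {k : SeedColor R} (hx : S.IsChordEnd x k) (z : Fin 4) :
    S.nextA (.inr false) (x, z) = (S.Z k x, z) := by
  classical
  simp [nextA, h.chordPerm_of_isChordEnd hx, layersA, S.layerZ_of_ne hx.ne_one hx.ne_two]

theorem nextA_one (x : V) (z : Fin 4) :
    S.nextA (.inl one) (x, z) = (S.Z (if z = 1 then two else one) x, z) := by
  rw [h.nextA_inl (fun hx => hx.ne_one rfl)]; rfl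

theorem nextA_two (x : V) (z : Fin 4) :
    S.nextA (.inl two) (x, z) = (S.Z (if z = 1 then one else two) x, z) := by
  rw [h.nextA_inl (fun hx => hx.ne_two rfl)]; rfl

omit h in
/-- A layer matching that is special in one layer only is jointly transitive with the columns. -/
theorem trans_column {p p₀ : V → V} (hp : ∀ x, S.par (p x) = !S.par x)
    (hpp : JointlyTransitive p p₀) (z₀ : Fin 4) (d : Bool) {s t : V × Fin 4 → V × Fin 4}
    (hs : ∀ x z, z ≠ z₀ → s (x, z) = (p x, z)) (hs₀ : ∀ x, s (x, z₀) = (p₀ x, z₀))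
    (ht : ∀ x z, t (x, z) = (x, S.column x d z)) : JointlyTransitive s t := by
  intro φ h1 h2
  refine constant_of_special_layer (P' := p) (P₀ := p₀) (U := fun x => S.column x d)
    (fun x => S.column_column x d) (fun x => S.column_ne x d) z₀ (fun x => ?_) hpp
    (fun x z hz => ?_) (fun x => ?_) (fun x z => ?_)
  -- As `p` reverses parity, the columns over `x` and `p x` carry the two complementary matchings of
  -- the 4-cycle.
  · have := squareFlip_trans (xor d (S.par x))
    unfold column
    rw [hp]
    simpa using this
  · rw [← hs x z hz, h1]
  · rw [← hs₀, h1]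
  · rw [← ht, h2]

theorem trans_one_column (d : Bool) {t : V × Fin 4 → V × Fin 4}
    (ht : ∀ x z, t (x, z) = (x, S.column x d z)) : JointlyTransitive (S.nextA (.inl one)) t :=
  trans_column (h.par_Z one) h.trans_ZZ 1 d (fun x z hz => by rw [h.nextA_one, if_neg hz])
    (fun x => by rw [h.nextA_one, if_pos rfl]) ht

theorem trans_two_column (d : Bool) {t : V × Fin 4 → V × Fin 4}
    (ht : ∀ x z, t (x, z) = (x, S.column x d z)) : JointlyTransitive (S.nextA (.inl two)) t :=
  trans_column (h.par_Z two) h.trans_ZZ.symm 1 d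
    (fun x z hz => by rw [h.nextA_two, if_neg hz]) (fun x => by rw [h.nextA_two, if_pos rfl]) ht

theorem trans_nextB_two_column {Q : SeedColor R → V → V}
    (hQ : JointlyTransitive (Q one) (S.Y two)) (d : Bool) {t : V × Fin 4 → V × Fin 4}
    (ht : ∀ x z, t (x, z) = (x, S.column x d z)) :
    JointlyTransitive (S.nextB Q (.inl two)) t :=
  trans_column (h.par_Y two) hQ.symm 0 d (fun x z hz => by simp [nextB, hz])
    (fun x => by simp [nextB, SeedColor.swap]) ht

/-- A single chord connects the four layers of a paired color. -/
theorem trans_link [Finite V] {k : SeedColor R} (h1 : k ≠ one) (h2 : k ≠ two) {u w : V}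
    (huw : S.Z k u = w) (hk : ∀ x, S.IsChordEnd x k ↔ x = u ∨ x = w) {Q : SeedColor R → V → V}
    (hQ : IsFactoring G Q) (hZY : JointlyTransitive (S.Z k) (S.Y k))
    (hZQ : JointlyTransitive (S.Z k) (Q k)) :
    JointlyTransitive (S.nextA (.inl k)) (S.nextB Q (.inl k)) := by
  intro φ hA hB
  have hswap : k.swap = k := by cases k <;> simp_all [SeedColor.swap]
  have hZ : ∀ x z, x ≠ u → x ≠ w → φ (S.Z k x, z) = φ (x, z) := fun x z hu hw => by
    rw [← h.nextA_inl_of_ne (by rw [hk]; tauto) h1 h2, hA]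
  have hP : ∀ z, ∃ q : V → V, (∀ x, q (q x) = x) ∧ (∀ x, q x ≠ x) ∧
      JointlyTransitive (S.Z k) q ∧ ∀ x, φ (q x, z) = φ (x, z) := fun z => by
    by_cases hz : z = 0
    · refine ⟨Q k, hQ.invol k, hQ.ne k, hZQ, fun x => ?_⟩
      have := hB (x, z)
      simpa [nextB, hz, hswap] using this
    · refine ⟨S.Y k, h.factoring_Y.invol k, h.factoring_Y.ne k, hZY, fun x => ?_⟩
      have := hB (x, z)
      simpa [nextB, hz] using this
  -- In a layer the chord is the only place where `Z k`-invariance can fail, and parity restores it.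
  have hlayer : ∀ z x y, φ (x, z) = φ (y, z) := fun z => by
    obtain ⟨q, hq, hq', hT, hφ⟩ := hP z
    have hwu : S.Z k w = u := by rw [← huw, h.Z_Z]
    have huw' := eq_along_exceptional_edge (h.factoring_Z.invol k) (h.factoring_Z.ne k) hq hq'
      (f := fun x => φ (x, z)) hφ huw fun x => hZ x z
    refine hT (fun x => φ (x, z)) (fun x => ?_) hφ
    by_cases hu : x = u
    · subst hu; simp only [huw]; exact huw'.symm
    by_cases hw : x = w
    · subst hw; simp only [hwu]; exact huw'
    exact hZ x z hu hw
  have hcol : ∀ x, (x = u ∨ x = w) → ∀ z, φ (x, S.column x false z) = φ (x, z) :=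
    fun x hx z => by rw [← h.nextA_inl_chord ((hk x).2 hx), hA]
  -- The chord ends have opposite parity, so their columns together supply both matchings of the
  -- 4-cycle.
  have hcolumn : ∀ z z', φ (u, z) = φ (u, z') := by
    refine eq_of_squareFlip_invariant (f := fun z => φ (u, z)) (S.par u) (fun z => ?_)
      (fun z => ?_)
    · simpa [column] using hcol u (Or.inl rfl) z
    · have := hcol w (Or.inr rfl) z
      rw [column, ← huw, h.par_Z, hlayer _ _ u, hlayer z _ u] at this
      simpa using this
  rintro ⟨x, z⟩ ⟨y, z'⟩
  rw [hlayer z x u, hlayer z' y u, hcolumn]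

end IsSeed

end SeedData

/-! ### Connectedness of the modified column color and of the unpaired color -/

namespace SeedData

open SeedColor

variable {V R : Type} (S : SeedData V R)

theorem isChordEnd_a {i : Option (Option R)} (hi : i ≠ some none) :
    S.IsChordEnd (S.a i) (fst i) := ⟨i, hi, Or.inl ⟨Or.inl rfl, rfl⟩⟩

theorem isChordEnd_b {i : Option (Option R)} (hi : i ≠ some none) :
    S.IsChordEnd (S.b i) (fst i) := ⟨i, hi, Or.inl ⟨Or.inr rfl, rfl⟩⟩

theorem isChordEnd_d {i : Option (Option R)} (hi : i ≠ some none) :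
    S.IsChordEnd (S.d i) (snd i) := ⟨i, hi, Or.inr ⟨Or.inl rfl, rfl⟩⟩

theorem isChordEnd_D {i : Option (Option R)} (hi : i ≠ some none) :
    S.IsChordEnd (S.D i) (snd i) := ⟨i, hi, Or.inr ⟨Or.inr rfl, rfl⟩⟩

/-- `x` is the end of a first chord of a site. -/
def IsFirst (x : V) : Prop := ∃ i ≠ some none, x = S.a i ∨ x = S.b i

namespace IsSeed

variable {S} {G : SimpleGraph V} (h : S.IsSeed G)
include h

theorem W_b : S.W (S.b none) = true := by rw [← h.chord none (by simp), fst, h.W_Z, h.W_a]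

theorem W_D : S.W (S.D none) = false := by rw [D, snd, h.W_Z, h.W_d]

omit h in
theorem eq_none_of_fst_eq_snd {i j : Option (Option R)} (h : fst i = snd j) :
    i = none ∧ j = none := by
  rcases i with _ | _ | i <;> rcases j with _ | _ | j <;> simp_all [fst, snd]

omit h in
theorem not_isFirst_of_off {x : V} (hx : S.OffChords x) : ¬ S.IsFirst x := by
  rintro ⟨i, hi, rfl | rfl⟩
  · exact hx _ (S.isChordEnd_a hi)
  · exact hx _ (S.isChordEnd_b hi)

/-- Parity excludes the vertices `a`. Against `b`, the chord color decides, except for `solo`, where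
`W` separates the two chords. -/
theorem not_isFirst_d {i : Option (Option R)} (hi : i ≠ some none) : ¬ S.IsFirst (S.d i) := by
  rintro ⟨j, hj, e | e⟩
  · have := h.par_d i
    rw [e, h.par_a] at this
    cases this
  · have hk := h.chordEnd_unique _ _ _ (e ▸ S.isChordEnd_d hi) (S.isChordEnd_b hj)
    obtain ⟨rfl, rfl⟩ := eq_none_of_fst_eq_snd hk.symm
    have := h.W_d
    rw [e, h.W_b] at this
    cases this

theorem not_isFirst_D {i : Option (Option R)} (hi : i ≠ some none) : ¬ S.IsFirst (S.D i) := by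
  rintro ⟨j, hj, e | e⟩
  · have hk := h.chordEnd_unique _ _ _ (e ▸ S.isChordEnd_D hi) (S.isChordEnd_a hj)
    obtain ⟨rfl, rfl⟩ := eq_none_of_fst_eq_snd hk.symm
    have := h.W_D
    rw [e, h.W_a] at this
    cases this
  · have := h.par_D i
    rw [e, h.par_b] at this
    cases this

theorem Y_d₂ (i : Option (Option R)) : S.Y two (S.d₂ i) = S.d i := by rw [d₂, h.Y_Y]

theorem Y_b (i : Option (Option R)) : S.Y one (S.b i) = S.d₂ i := by rw [b, h.Y_Y]

theorem Y_d (i : Option (Option R)) : S.Y one (S.d i) = S.a i := by rw [d, h.Y_Y]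

/-- The chords of the first distinguished new color do not disconnect it. -/
theorem trans_chords [Finite V] {Q : SeedColor R → V → V} (hQ : ∀ x, Q two x = S.Y two x) :
    JointlyTransitive (S.nextA (.inr false)) (S.nextB Q (.inl one)) := by
  classical
  intro φ hA hB
  have hoff : ∀ x, S.OffChords x → ∀ z, φ (x, S.column x false z) = φ (x, z) := fun x hx z => by
    rw [← nextA_inr_false hx, hA]
  have hch : ∀ x k, S.IsChordEnd x k → ∀ z, φ (S.Z k x, z) = φ (x, z) := fun x k hx z => by
    rw [← h.nextA_inr_false_chord hx, hA]
  have hY : ∀ x z, z ≠ 0 → φ (S.Y one x, z) = φ (x, z) := fun x z hz => by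
    have := hB (x, z)
    simpa [nextB, hz] using this
  have h0 : ∀ x, φ (S.Y two x, 0) = φ (x, 0) := fun x => by
    have := hB (x, 0)
    simpa [nextB, SeedColor.swap, hQ] using this
  -- Two intact columns of opposite parity that agree off layer `0` agree there by parity; carrying
  -- complementary matchings, they are then constant.
  have htwo : ∀ x y, S.OffChords x → S.OffChords y → S.par y = !S.par x →
      (∀ z, z ≠ 0 → φ (x, z) = φ (y, z)) →
      (∀ z, φ (x, z) = φ (y, z)) ∧ ∀ z w, φ (x, z) = φ (x, w) := by
    intro x y hx hy hp he
    have e : ∀ z, φ (x, z) = φ (y, z) := congrFun (eq_of_invariant_of_eq_off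
      (S.column_column x false) (S.column_ne x false) (S.column_column y false)
      (S.column_ne y false) (hoff x hx) (hoff y hy) 0 he)
    refine ⟨e, eq_of_squareFlip_invariant (f := fun z => φ (x, z)) (S.par x)
      (fun z => by simpa [column] using hoff x hx z) fun z => ?_⟩
    have := hoff y hy z
    rw [← e, ← e, column, hp] at this
    simpa using this
  have hab : ∀ i, i ≠ some none → ∀ z, φ (S.b i, z) = φ (S.a i, z) := fun i hi z => by
    rw [← h.chord i hi]; exact hch _ _ (S.isChordEnd_a hi) z
  have hdD : ∀ i, i ≠ some none → ∀ z, φ (S.D i, z) = φ (S.d i, z) := fun i hi z =>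
    hch _ _ (S.isChordEnd_d hi) z
  have hda : ∀ i z, z ≠ 0 → φ (S.d i, z) = φ (S.a i, z) := fun i z hz => hY _ z hz
  have hd₂b : ∀ i z, z ≠ 0 → φ (S.b i, z) = φ (S.d₂ i, z) := fun i z hz => hY _ z hz
  -- Off layer `0`, the path `d₂`, `b`, `a`, `d`, `D`, `Y one D` joins two intact columns of
  -- opposite parity.
  have hsite : ∀ i, i ≠ some none → (∀ z, φ (S.d₂ i, z) = φ (S.Y one (S.D i), z)) ∧
      ∀ z w, φ (S.d₂ i, z) = φ (S.d₂ i, w) := fun i hi => by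
    refine htwo _ _ (h.off_d₂ i hi) (h.off_YD i hi one (Or.inl rfl)) ?_ fun z hz => ?_
    · rw [h.par_Y, h.par_D, h.par_d₂]
    · rw [hY _ z hz, hdD i hi, hda i z hz, ← hab i hi, hd₂b i z hz]
  have hconst : ∀ x, S.OffChords x → ∀ z w, φ (x, z) = φ (x, w) := fun x hx => by
    by_cases hx' : S.OffChords (S.Y one x)
    · exact (htwo x _ hx hx' (h.par_Y _ _) fun z hz => (hY x z hz).symm).2
    · simp only [OffChords, not_forall, not_not] at hx'
      obtain ⟨k, i, hi, ⟨e | e, -⟩ | ⟨e | e, -⟩⟩ := hx'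
      · exact absurd (S.isChordEnd_d hi) (by rw [d, ← e, h.Y_Y]; exact hx _)
      · rw [← h.Y_Y one x, e, h.Y_b]; exact (hsite i hi).2
      · exact absurd (S.isChordEnd_a hi) (by rw [← h.Y_d, ← e, h.Y_Y]; exact hx _)
      · rw [← h.Y_Y one x, e]
        intro z w
        rw [← (hsite i hi).1, ← (hsite i hi).1, (hsite i hi).2]
  have hsite' : ∀ i, i ≠ some none → ∀ z, z ≠ 0 → φ (S.a i, z) = φ (S.d₂ i, 0) :=
    fun i hi z hz => by rw [← hab i hi, hd₂b i z hz, (hsite i hi).2 z 0]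
  have hz : ∀ x z, z ≠ 0 → φ (x, z) = φ (x, 1) := fun x z hz => by
    by_cases hx : S.OffChords x
    · exact hconst x hx _ _
    · simp only [OffChords, not_forall, not_not] at hx
      obtain ⟨k, i, hi, ⟨rfl | rfl, -⟩ | ⟨rfl | rfl, -⟩⟩ := hx
      · rw [hsite' i hi z hz, hsite' i hi 1 (by simp)]
      · rw [hab i hi, hab i hi, hsite' i hi z hz, hsite' i hi 1 (by simp)]
      · rw [hda i z hz, hda i 1 (by simp), hsite' i hi z hz, hsite' i hi 1 (by simp)]
      · rw [hdD i hi, hdD i hi, hda i z hz, hda i 1 (by simp), hsite' i hi z hz,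
          hsite' i hi 1 (by simp)]
  have hd0 : ∀ i, i ≠ some none → φ (S.d i, 0) = φ (S.d i, 1) := fun i hi => by
    rw [hda i 1 (by simp), hsite' i hi 1 (by simp), d₂, h0]
  have hzero : ∀ x, ¬ S.IsFirst x → φ (x, 0) = φ (x, 1) := fun x hx => by
    by_cases hx' : S.OffChords x
    · exact hconst x hx' _ _
    · simp only [OffChords, not_forall, not_not] at hx'
      obtain ⟨k, i, hi, ⟨e, -⟩ | ⟨rfl | rfl, -⟩⟩ := hx'
      · exact absurd ⟨i, hi, e⟩ hx
      · exact hd0 i hi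
      · rw [hdD i hi, hdD i hi, hd0 i hi]
  -- Only over the ends `a`, `b` of first chords can layer `0` still differ from the others. `g` is
  -- layer `1`, with the values over the `Y one`-edges `a`–`d` and `b`–`d₂` replaced by those over
  -- `a` and `b` in layer `0`. This makes it invariant under `Y one` and `Y two`.
  let g : V → Bool := fun x => if S.IsFirst x then φ (x, 0) else
    if S.IsFirst (S.Y one x) then φ (S.Y one x, 0) else φ (x, 1)
  have hfirst : ∀ x, S.IsFirst x → ¬ S.IsFirst (S.Y one x) := by
    rintro x ⟨i, hi, rfl | rfl⟩
    · exact h.not_isFirst_d hi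
    · rw [h.Y_b]; exact not_isFirst_of_off (h.off_d₂ i hi)
  have hnot : ∀ x, S.OffChords x → (∀ i ≠ some none, S.Y two x ≠ S.d i) →
      ¬ S.IsFirst x ∧ ¬ S.IsFirst (S.Y one x) := by
    intro x hx hne
    refine ⟨not_isFirst_of_off hx, ?_⟩
    rintro ⟨i, hi, e | e⟩
    · exact hx _ (by rw [← h.Y_Y one x, e]; exact S.isChordEnd_d hi)
    · exact hne i hi (by rw [← h.Y_Y one x, e, h.Y_b, h.Y_d₂])
  have hgY : ∀ x, g (S.Y one x) = g x := fun x => by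
    simp only [g, h.Y_Y]
    by_cases h1 : S.IsFirst x
    · rw [if_neg (hfirst x h1), if_pos h1, if_pos h1]
    · by_cases h2 : S.IsFirst (S.Y one x)
      · rw [if_pos h2, if_neg h1, if_pos h2]
      · rw [if_neg h2, if_neg h1, if_neg h1, if_neg h2, hY x 1 (by simp)]
  have hg1 : ∀ x, S.IsFirst x → g x = φ (x, 0) := fun x hx => if_pos hx
  have hg2 : ∀ x, S.IsFirst (S.Y one x) → g x = φ (S.Y one x, 0) := fun x hx => by
    rw [← hgY, hg1 _ hx]
  have hg3 : ∀ x, ¬ S.IsFirst x → ¬ S.IsFirst (S.Y one x) → g x = φ (x, 1) :=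
    fun x h1 h2 => by simp only [g, if_neg h1, if_neg h2]
  have hgspecial : ∀ x, S.IsFirst x ∨ S.IsFirst (S.Y one x) → g (S.Y two x) = g x := by
    rintro x (hx | hx)
    · have hn : ¬ S.IsFirst (S.Y two x) ∧ ¬ S.IsFirst (S.Y one (S.Y two x)) := by
        obtain ⟨i, hi, rfl | rfl⟩ := hx
        · refine hnot _ (h.off_a₀ i hi) fun j hj e => ?_
          rw [h.Y_Y] at e
          have := h.par_a i
          rw [e, h.par_d] at this
          cases this
        · refine hnot _ (h.off_b₀ i hi) fun j hj e => ?_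
          rw [h.Y_Y] at e
          exact h.not_isFirst_d hj ⟨i, hi, Or.inr e.symm⟩
      rw [hg1 x hx, hg3 _ hn.1 hn.2, ← hzero _ hn.1, h0]
    · obtain ⟨i, hi, e | e⟩ := hx
      · have hx : x = S.d i := by rw [← h.Y_Y one x, e]; rfl
        subst hx
        have h2 : S.IsFirst (S.Y one (S.d₂ i)) := ⟨i, hi, Or.inr rfl⟩
        have h1 : S.IsFirst (S.Y one (S.d i)) := ⟨i, hi, Or.inl (h.Y_d i)⟩
        rw [hg2 _ h1, h.Y_d, ← hab i hi]
        exact hg2 _ h2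
      · have hx : x = S.d₂ i := by rw [← h.Y_Y one x, e, h.Y_b]
        subst hx
        have h2 : S.IsFirst (S.Y one (S.d₂ i)) := ⟨i, hi, Or.inr rfl⟩
        have h1 : S.IsFirst (S.Y one (S.d i)) := ⟨i, hi, Or.inl (h.Y_d i)⟩
        rw [h.Y_d₂, hg2 _ h1, h.Y_d, ← hab i hi]
        exact (hg2 _ h2).symm
  have hgY2 : ∀ x, g (S.Y two x) = g x := fun x => by
    by_cases h1 : S.IsFirst x ∨ S.IsFirst (S.Y one x)
    · exact hgspecial x h1
    by_cases h2 : S.IsFirst (S.Y two x) ∨ S.IsFirst (S.Y one (S.Y two x))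
    · have := hgspecial _ h2
      rw [h.Y_Y] at this
      exact this.symm
    rw [not_or] at h1 h2
    rw [hg3 _ h1.1 h1.2, hg3 _ h2.1 h2.2, ← hzero _ h1.1, ← hzero _ h2.1, h0]
  have hg := h.trans_YY g hgY hgY2
  -- `D` is untouched by the replacement, so the constant `g` is the true layer-1 value at `D`, from
  -- where it spreads to `d`, `a` and `b`.
  have hD : ∀ i, i ≠ some none → ∀ y, φ (S.D i, 1) = g y := fun i hi y => by
    rw [← hg3 _ (h.not_isFirst_D hi)
      (not_isFirst_of_off (h.off_YD i hi one (Or.inl rfl)))]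
    exact hg _ _
  have he : ∀ x y, φ (x, 1) = g y := fun x y => by
    by_cases h1 : S.IsFirst x
    · obtain ⟨i, hi, rfl | rfl⟩ := h1
      · rw [← hda i 1 (by simp), ← hdD i hi, hD i hi y]
      · rw [hab i hi, ← hda i 1 (by simp), ← hdD i hi, hD i hi y]
    by_cases h2 : S.IsFirst (S.Y one x)
    · rw [← hY x 1 (by simp)]
      obtain ⟨i, hi, e | e⟩ := h2 <;> rw [e]
      · rw [← hda i 1 (by simp), ← hdD i hi, hD i hi y]
      · rw [hab i hi, ← hda i 1 (by simp), ← hdD i hi, hD i hi y]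
    rw [← hg3 x h1 h2]
    exact hg _ _
  have hall : ∀ x z y, φ (x, z) = g y := fun x z y => by
    by_cases hz0 : z = 0
    · subst hz0
      by_cases h1 : S.IsFirst x
      · rw [← hg1 x h1]; exact hg _ _
      · rw [hzero x h1, he]
    · rw [hz x z hz0, he]
  rintro ⟨x, z⟩ ⟨y, w⟩
  rw [hall x z x, hall y w x]

/-- The data of the unpaired color: invariance in all layers, with a freely chosen layer `0`. -/
theorem solo_invariance {Q : SeedColor R → V → V} {φ : V × Fin 4 → Bool}
    (hA : ∀ v, φ (S.nextA (.inl solo) v) = φ v) (hB : ∀ v, φ (S.nextB Q (.inl solo) v) = φ v) :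
    (∀ x z, ¬ S.IsChordEnd x solo → φ (S.Z solo x, z) = φ (x, z)) ∧
    (∀ x, S.IsChordEnd x solo → ∀ z, φ (x, squareFlip (S.par x) z) = φ (x, z)) ∧
    (∀ x z, z ≠ 0 → φ (S.Y solo x, z) = φ (x, z)) ∧ ∀ x, φ (Q solo x, 0) = φ (x, 0) := by
  refine ⟨fun x z hx => ?_, fun x hx z => ?_, fun x z hz => ?_, fun x => ?_⟩
  · rw [← h.nextA_inl_of_ne hx (by simp) (by simp), hA]
  · have := hA (x, z)
    rw [h.nextA_inl_chord hx] at this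
    simpa [column] using this
  · have := hB (x, z)
    simpa [nextB, hz] using this
  · have := hB (x, 0)
    simpa [nextB, SeedColor.swap] using this

/-- In a layer with invariance under `Y solo`, the invariant set `P` links the two chords. -/
theorem solo_layer [Finite V] {f : V → Bool}
    (hZ : ∀ x, ¬ S.IsChordEnd x solo → f (S.Z solo x) = f x) (hY : ∀ x, f (S.Y solo x) = f x) :
    f (S.a none) = f (S.d none) ∧ f (S.b none) = f (S.D none) := by
  have key : ∀ g : V → Bool, (∀ x, ¬ S.IsChordEnd x solo → g (S.Z solo x) = g x) →
      (∀ x, g (S.Y solo x) = g x) →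
      (g (S.a none) = g (S.b none) ↔ g (S.d none) = g (S.D none)) := fun g hg hg' =>
    xor_eq_along_exceptional_edges (h.factoring_Z.invol solo) (h.factoring_Z.ne solo)
      (h.factoring_Y.invol solo) (h.factoring_Y.ne solo) hg' (h.chord none (by simp)) rfl
      fun x h1 h2 h3 h4 => hg x (by rw [isChordEnd_solo]; tauto)
  have k1 := key f hZ hY
  -- Restricting to `P` keeps only the ends `a` and `d`, so the parity relation becomes an equality
  -- of their two values.
  have k2 := key (fun x => f x && S.P x) (fun x hx => by simp only [hZ x hx, h.P_Z x hx])
    (fun x => by simp only [hY, h.P_Y])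
  simp only [h.P_a, h.P_b, h.P_d, h.P_D, Bool.and_true, Bool.and_false] at k2
  revert k1 k2
  generalize f (S.a none) = p; generalize f (S.b none) = q
  generalize f (S.d none) = r; generalize f (S.D none) = s
  revert p q r s
  decide

omit h in
theorem solo_Z_invariant {f : V → Bool} (h : S.IsSeed G)
    (hZ : ∀ x, ¬ S.IsChordEnd x solo → f (S.Z solo x) = f x)
    (hab : f (S.a none) = f (S.b none)) (hdD : f (S.d none) = f (S.D none)) (x : V) :
    f (S.Z solo x) = f x := by
  have e1 : S.Z solo (S.a none) = S.b none := h.chord none (by simp)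
  have e2 : S.Z solo (S.b none) = S.a none := by rw [← e1, h.Z_Z]
  have e3 : S.Z solo (S.d none) = S.D none := rfl
  have e4 : S.Z solo (S.D none) = S.d none := by rw [← e3, h.Z_Z]
  by_cases hx : S.IsChordEnd x solo
  · obtain (rfl | rfl) | (rfl | rfl) := (S.isChordEnd_solo x).1 hx
    · rw [e1, hab]
    · rw [e2, hab]
    · rw [e3, hdD]
    · rw [e4, hdD]
  · exact hZ x hx

/-- The unpaired color is connected when layer `0` uses the variant factorization. -/
theorem trans_solo [Finite V] :
    JointlyTransitive (S.nextA (.inl solo)) (S.nextB S.Y' (.inl solo)) := by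
  intro φ hA hB
  obtain ⟨hZ, hC, hY, hY'⟩ := h.solo_invariance hA hB
  have hca := hC _ ((S.isChordEnd_solo _).2 (Or.inl (Or.inl rfl)))
  have hcb := hC _ ((S.isChordEnd_solo _).2 (Or.inl (Or.inr rfl)))
  have hcd := hC _ ((S.isChordEnd_solo _).2 (Or.inr (Or.inl rfl)))
  have hcD := hC _ ((S.isChordEnd_solo _).2 (Or.inr (Or.inr rfl)))
  rw [h.par_a] at hca
  rw [h.par_b] at hcb
  rw [h.par_d] at hcd
  rw [h.par_D] at hcD
  have hlink : ∀ z, z ≠ 0 → φ (S.a none, z) = φ (S.d none, z) ∧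
      φ (S.b none, z) = φ (S.D none, z) := fun z hz =>
    h.solo_layer (f := fun x => φ (x, z)) (fun x => hZ x z) fun x => hY x z hz
  -- Cutting `φ` down to one orbit of layer `0` leaves a single chord as exceptional edge.
  have hzero : ∀ U : V → Bool, (∀ x, U (S.Z solo x) = U x) → (∀ x, U (S.Y' solo x) = U x) →
      ∀ u w, S.Z solo u = w → (∀ x, x ≠ u → x ≠ w → U x = true → ¬ S.IsChordEnd x solo) →
      U u = true → φ (u, 0) = φ (w, 0) := by
    intro U hUZ hUY u w huw hU hu
    have hw : U w = true := by rw [← huw, hUZ, hu]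
    have := eq_along_exceptional_edge (h.factoring_Z.invol solo) (h.factoring_Z.ne solo)
      (h.factoring_Y'.invol solo) (h.factoring_Y'.ne solo) (f := fun x => φ (x, 0) && U x)
      (fun x => by simp only [hY', hUY]) huw fun x h1 h2 => by
        simp only [hUZ]
        by_cases hx : U x = true
        · rw [hZ x 0 (hU x h1 h2 hx)]
        · simp [hx]
    simpa [hu, hw] using this
  have hab : φ (S.a none, 0) = φ (S.b none, 0) := by
    refine hzero S.W h.W_Z h.W_Y' _ _ (h.chord none (by simp)) (fun x h1 h2 hx hx' => ?_) h.W_a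
    obtain (rfl | rfl) | (rfl | rfl) := (S.isChordEnd_solo x).1 hx'
    · exact h1 rfl
    · exact h2 rfl
    · rw [h.W_d] at hx; cases hx
    · rw [h.W_D] at hx; cases hx
  have hdD : φ (S.d none, 0) = φ (S.D none, 0) := by
    refine hzero (fun x => !S.W x) (fun x => by simp only [h.W_Z]) (fun x => by simp only [h.W_Y'])
      _ _ rfl (fun x h1 h2 hx hx' => ?_) (by simp only [h.W_d]; rfl)
    obtain (rfl | rfl) | (rfl | rfl) := (S.isChordEnd_solo x).1 hx'
    · simp only [h.W_a] at hx; cases hx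
    · simp only [h.W_b] at hx; cases hx
    · exact h1 rfl
    · exact h2 rfl
  have a01 := hca 0
  have a23 := hca 2
  have b12 := hcb 1
  have b30 := hcb 0
  have d12 := hcd 1
  have d30 := hcd 0
  have D01 := hcD 0
  have D23 := hcD 2
  have l1 := hlink 1 (by simp)
  have l2 := hlink 2 (by simp)
  have l3 := hlink 3 (by simp)
  simp only [squareFlip, Fin.isValue, Matrix.cons_val] at a01 a23 b12 b30 d12 d30 D01 D23
  -- Columns over `a` and `D` join layers 0–1 and 2–3, those over `b` and `d` join 0–3 and 1–2. With
  -- the links `a`–`b`, `d`–`D` in layer `0` and `a`–`d`, `b`–`D` elsewhere, these form one cycle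
  -- through all 16 vertices.
  have hall : ∀ z, φ (S.a none, z) = φ (S.a none, 0) ∧ φ (S.b none, z) = φ (S.a none, 0) ∧
      φ (S.d none, z) = φ (S.a none, 0) ∧ φ (S.D none, z) = φ (S.a none, 0) := by
    intro z
    fin_cases z <;> simp only [Fin.isValue, Fin.mk_zero, Fin.mk_one, Fin.reduceFinMk] <;> grind
  have hZ' : ∀ x z, φ (S.Z solo x, z) = φ (x, z) := fun x z =>
    solo_Z_invariant (f := fun x => φ (x, z)) h (fun x => hZ x z)
      ((hall z).1.trans (hall z).2.1.symm) ((hall z).2.2.1.trans (hall z).2.2.2.symm) x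
  have hval : ∀ x z, φ (x, z) = φ (S.a none, 0) := fun x z => by
    by_cases hz : z = 0
    · subst hz
      have horb := h.W_orbit (fun x => φ (x, 0)) (fun x => hZ' x 0) hY'
      cases hx : S.W x with
      | true => exact horb x _ (by rw [hx, h.W_a])
      | false => rw [horb x (S.d none) (by rw [hx, h.W_d]), (hall 0).2.2.1]
    · rw [← (hall z).1]
      exact h.trans_ZY solo (fun x => φ (x, z)) (fun x => hZ' x z) (fun x => hY x z hz) _ _
  rintro ⟨x, z⟩ ⟨y, w⟩
  rw [hval, hval y]

/-- With `Y` in all layers, the orbits of the unpaired color are given by `P`. -/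
theorem solo_orbit [Finite V] {φ : V × Fin 4 → Bool} (hA : ∀ v, φ (S.nextA (.inl solo) v) = φ v)
    (hB : ∀ v, φ (S.nextB S.Y (.inl solo) v) = φ v) (v w : V × Fin 4) (hvw : S.P v.1 = S.P w.1) :
    φ v = φ w := by
  obtain ⟨hZ, hC, hY, hY0⟩ := h.solo_invariance hA hB
  replace hY : ∀ x z, φ (S.Y solo x, z) = φ (x, z) := fun x z => by
    by_cases hz : z = 0
    · rw [hz, hY0]
    · exact hY x z hz
  have hca := hC _ ((S.isChordEnd_solo _).2 (Or.inl (Or.inl rfl)))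
  have hcb := hC _ ((S.isChordEnd_solo _).2 (Or.inl (Or.inr rfl)))
  have hcd := hC _ ((S.isChordEnd_solo _).2 (Or.inr (Or.inl rfl)))
  have hcD := hC _ ((S.isChordEnd_solo _).2 (Or.inr (Or.inr rfl)))
  rw [h.par_a] at hca
  rw [h.par_b] at hcb
  rw [h.par_d] at hcd
  rw [h.par_D] at hcD
  have hlink : ∀ z, φ (S.a none, z) = φ (S.d none, z) ∧
      φ (S.b none, z) = φ (S.D none, z) := fun z =>
    h.solo_layer (f := fun x => φ (x, z)) (fun x => hZ x z) fun x => hY x z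
  have hconst : ∀ u, ∀ d, (∀ z, φ (u, squareFlip d z) = φ (u, z)) →
      (∀ z, φ (u, squareFlip (!d) z) = φ (u, z)) → ∀ z, φ (u, z) = φ (u, 0) :=
    fun u d h1 h2 z => eq_of_squareFlip_invariant (f := fun z => φ (u, z)) d h1 h2 z 0
  have ha : ∀ z, φ (S.a none, z) = φ (S.a none, 0) := hconst _ false hca fun z => by
    rw [(hlink _).1, (hlink _).1]; exact hcd z
  have hb : ∀ z, φ (S.b none, z) = φ (S.b none, 0) := hconst _ true hcb fun z => by
    rw [(hlink _).2, (hlink _).2]; exact hcD z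
  have hval : ∀ x z, φ (x, z) = if S.P x then φ (S.a none, 0) else φ (S.b none, 0) := by
    intro x z
    -- Both chords lead out of `P`. Overwriting the values off `P` by the one at `a` makes the
    -- function invariant along the chords as well, hence constant.
    have h1 := h.trans_ZY solo (fun x => if S.P x then φ (x, z) else φ (S.a none, 0))
      (solo_Z_invariant (f := fun x => if S.P x then φ (x, z) else φ (S.a none, 0)) h (fun x hx => by simp only [h.P_Z x hx, hZ x z hx])
        (by simp only [h.P_a, h.P_b]; simpa using ha z)
        (by simp only [h.P_d, h.P_D]; simpa [← (hlink z).1] using ha z))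
      (fun x => by simp only [h.P_Y, hY])
    have h2 := h.trans_ZY solo (fun x => if S.P x then φ (S.b none, 0) else φ (x, z))
      (solo_Z_invariant (f := fun x => if S.P x then φ (S.b none, 0) else φ (x, z)) h (fun x hx => by simp only [h.P_Z x hx, hZ x z hx])
        (by simp only [h.P_a, h.P_b]; simpa using (hb z).symm)
        (by simp only [h.P_d, h.P_D]; simpa [← (hlink z).2] using (hb z).symm))
      (fun x => by simp only [h.P_Y, hY])
    cases hx : S.P x with
    | true => simpa [hx, h.P_b] using h1 x (S.b none)
    | false => simpa [hx, h.P_a] using h2 x (S.a none)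
  obtain ⟨x, z⟩ := v
  obtain ⟨y, w⟩ := w
  rw [hval, hval y, show S.P x = S.P y from hvw]

end IsSeed

end SeedData

/-! ### The next seed satisfies the axioms -/

namespace SeedData

open SeedColor

variable {V R : Type} (S : SeedData V R)

/-- The seed on `V × Fin 4` derived from a seed on `V`. -/
noncomputable def next : SeedData (V × Fin 4) (Option R) where
  par v := xor (S.par v.1) (![true, false, true, false] v.2)
  Z c := S.nextA (nextLeft c)
  Y c := S.nextB S.Y' (nextRight c)
  Y' c := S.nextB S.Y (nextRight c)
  a
    | none => (S.a none, 3)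
    | some none => (S.a (some none), 1)
    | some (some r) => (S.a (some r), 3)
  W v := S.P v.1
  P v := ![!S.W v.1, !S.P v.1, !S.P v.1, S.P v.1 || S.T v.1] v.2
  T v := ![S.W v.1, false, false, !S.P v.1 && !S.T v.1] v.2

/-- The site of the old seed underlying a site of the next one. -/
def site : Option (Option (Option R)) → Option (Option R)
  | none => none
  | some none => some none
  | some (some r) => some r

theorem site_injective {j j' : Option (Option (Option R))} (hj : j ≠ some none)
    (hj' : j' ≠ some none) (e : site j = site j') : j = j' := by
  rcases j with _ | _ | j <;> rcases j' with _ | _ | j' <;> simp_all [site]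

theorem next_a {j : Option (Option (Option R))} (hj : j ≠ some none) :
    S.next.a j = (S.a (site j), 3) := by
  rcases j with _ | _ | j
  · rfl
  · exact absurd rfl hj
  · rfl

theorem nextLeft_snd {j : Option (Option (Option R))} (hj : j ≠ some none) :
    nextLeft (snd j) = .inl (snd (site j)) := by
  rcases j with _ | _ | _ | j <;> first | rfl | exact absurd rfl hj

theorem next_Y_one (x : V) {z : Fin 4} (hz : z ≠ 0) : S.next.Y one (x, z) = (S.Y two x, z) := by
  simp [next, nextB, nextRight, hz]

theorem next_Y_two (x : V) (z : Fin 4) :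
    S.next.Y two (x, z) = (x, squareFlip (!S.par x) z) := by
  simp [next, nextB, nextRight, column]

theorem next_d {j : Option (Option (Option R))} (hj : j ≠ some none) :
    S.next.d j = (S.a₀ (site j), 3) := by
  rw [d, S.next_a hj, next_Y_one _ _ (by simp)]; rfl

namespace IsSeed

variable {S} {G : SimpleGraph V} (h : S.IsSeed G)
include h

theorem next_d₂ {j : Option (Option (Option R))} (hj : j ≠ some none) :
    S.next.d₂ j = (S.a₀ (site j), 2) := by
  rw [d₂, S.next_d hj, next_Y_two, h.par_a₀]; rfl

theorem next_b {j : Option (Option (Option R))} (hj : j ≠ some none) :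
    S.next.b j = (S.a (site j), 2) := by
  rw [b, h.next_d₂ hj, next_Y_one _ _ (by simp), a₀, h.Y_Y]

theorem next_a₀ {j : Option (Option (Option R))} (hj : j ≠ some none) :
    S.next.a₀ j = (S.a (site j), 0) := by
  rw [a₀, S.next_a hj, next_Y_two, h.par_a]; rfl

theorem next_b₀ {j : Option (Option (Option R))} (hj : j ≠ some none) :
    S.next.Y two (S.next.b j) = (S.a (site j), 1) := by
  rw [h.next_b hj, next_Y_two, h.par_a]; rfl

theorem nextA_snd {i : Option (Option R)} {x : V} (hx : ¬ S.IsChordEnd x (snd i)) {z : Fin 4}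
    (hz : z ≠ 1) : S.nextA (.inl (snd i)) (x, z) = (S.Z (snd i) x, z) := by
  rw [h.nextA_inl hx, layerZ, if_neg hz]

omit h in
theorem not_isChordEnd_spare (x : V) : ¬ S.IsChordEnd x (snd (some none)) := fun hx => hx.ne_two rfl

theorem next_D {j : Option (Option (Option R))} (hj : j ≠ some none) :
    S.next.D j = (S.E (site j), 3) := by
  rw [D, S.next_d hj]
  change S.nextA (nextLeft (snd j)) _ = _
  rw [nextLeft_snd hj, h.nextA_snd _ (by simp)]
  · rfl
  · by_cases hi : site j = some none
    · rw [hi]; exact not_isChordEnd_spare _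
    · exact h.off_a₀ _ hi _

theorem next_YD_one {j : Option (Option (Option R))} (hj : j ≠ some none) :
    S.next.Y one (S.next.D j) = (S.Y two (S.E (site j)), 3) := by
  rw [h.next_D hj, next_Y_one _ _ (by simp)]

theorem next_YD_two {j : Option (Option (Option R))} (hj : j ≠ some none) :
    S.next.Y two (S.next.D j) = (S.E (site j), 0) := by
  rw [h.next_D hj, next_Y_two, h.par_E]; rfl

theorem next_chord {j : Option (Option (Option R))} (hj : j ≠ some none) :
    S.next.Z (fst j) (S.next.a j) = S.next.b j := by
  rw [S.next_a hj, h.next_b hj]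
  change S.nextA (nextLeft (fst j)) _ = _
  have key : S.column (S.a (site j)) false 3 = 2 := by rw [column, h.par_a]; rfl
  rcases j with _ | _ | _ | r
  · exact (h.nextA_inl_chord (S.isChordEnd_a (i := none) (by simp)) 3).trans (by rw [← key]; rfl)
  · exact absurd rfl hj
  · exact (nextA_inr_false h.off_spare 3).trans (by rw [← key]; rfl)
  · exact (h.nextA_inl_chord (S.isChordEnd_a (i := some (some r)) (by simp)) 3).trans
      (by rw [← key]; rfl)

theorem not_isChordEnd_a_snd (r : Option R) : ¬ S.IsChordEnd (S.a (some r)) (snd (some r)) := by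
  rcases r with _ | r
  · exact not_isChordEnd_spare _
  · intro hx
    have := h.chordEnd_unique _ _ _ hx (S.isChordEnd_a (i := some (some r)) (by simp))
    cases this

theorem next_E_none : S.next.E none = (S.a none, 1) := by
  rw [E, h.next_a₀ (by simp)]
  refine (h.nextA_inl_chord (S.isChordEnd_a (i := none) (by simp)) 0).trans ?_
  rw [column, h.par_a]; rfl

theorem next_E_spare : S.next.E (some none) = (S.Z one (S.a (some none)), 2) := by
  have h1 : S.next.a (some none) = (S.a (some none), 1) := rfl
  rw [E, a₀, h1, next_Y_two, h.par_a]
  exact h.nextA_one _ 2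

theorem next_E_some (r : Option R) : S.next.E (some (some r)) = (S.F (some r), 0) := by
  rw [E, h.next_a₀ (by simp)]
  change S.nextA (nextLeft (snd _)) _ = _
  rw [nextLeft_snd (by simp)]
  exact h.nextA_snd (h.not_isChordEnd_a_snd r) (by simp)

theorem next_F_spare : S.next.F (some none) = (S.F (some none), 1) := by
  have h1 : S.next.a (some none) = (S.a (some none), 1) := rfl
  rw [F, h1]
  exact h.nextA_one _ 1

theorem next_F_some (r : Option R) : S.next.F (some (some r)) = (S.F (some r), 3) := by
  rw [F, S.next_a (by simp)]
  change S.nextA (nextLeft (snd _)) _ = _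
  rw [nextLeft_snd (by simp)]
  exact h.nextA_snd (h.not_isChordEnd_a_snd r) (by simp)

theorem next_chordEnd_cases {v : V × Fin 4} {k : SeedColor (Option R)}
    (hv : S.next.IsChordEnd v k) : ∃ j ≠ some none,
      (v.1 = S.a (site j) ∧ (v.2 = 2 ∨ v.2 = 3) ∧ k = fst j) ∨
      (v.1 = S.a₀ (site j) ∧ v.2 = 3 ∧ k = snd j) ∨ (v.1 = S.E (site j) ∧ v.2 = 3 ∧ k = snd j) := by
  obtain ⟨j, hj, ⟨rfl | rfl, rfl⟩ | ⟨rfl | rfl, rfl⟩⟩ := hv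
  · exact ⟨j, hj, by simp [S.next_a hj]⟩
  · exact ⟨j, hj, by simp [h.next_b hj]⟩
  · exact ⟨j, hj, by simp [S.next_d hj]⟩
  · exact ⟨j, hj, by simp [h.next_D hj]⟩

theorem a_ne_a₀ (i j : Option (Option R)) : S.a i ≠ S.a₀ j := fun e => by
  have := h.par_a i
  rw [e, h.par_a₀] at this
  cases this

theorem E_ne_a₀ (i j : Option (Option R)) : S.E i ≠ S.a₀ j := fun e => by
  have := h.par_E i
  rw [e, h.par_a₀] at this
  cases this

theorem a₀_inj {i j : Option (Option R)} (e : S.a₀ i = S.a₀ j) : i = j :=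
  h.a_inj _ _ (by rw [← h.Y_Y two (S.a i), ← h.Y_Y two (S.a j)]; exact congrArg _ e)

theorem next_chordEnd_unique (v : V × Fin 4) (k k' : SeedColor (Option R))
    (hk : S.next.IsChordEnd v k) (hk' : S.next.IsChordEnd v k') : k = k' := by
  obtain ⟨j, hj, hv⟩ := h.next_chordEnd_cases hk
  obtain ⟨j', hj', hv'⟩ := h.next_chordEnd_cases hk'
  have same : site j = site j' → j = j' := site_injective hj hj'
  rcases hv with ⟨e, -, rfl⟩ | ⟨e, -, rfl⟩ | ⟨e, -, rfl⟩ <;>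
    rcases hv' with ⟨e', -, rfl⟩ | ⟨e', -, rfl⟩ | ⟨e', -, rfl⟩
  · rw [same (h.a_inj _ _ (e.symm.trans e'))]
  · exact absurd (e.symm.trans e') (h.a_ne_a₀ _ _)
  · exact absurd (e'.symm.trans e) (h.E_ne_a _ _)
  · exact absurd (e'.symm.trans e) (h.a_ne_a₀ _ _)
  · rw [same (h.a₀_inj (e.symm.trans e'))]
  · exact absurd (e'.symm.trans e) (h.E_ne_a₀ _ _)
  · exact absurd (e.symm.trans e') (h.E_ne_a _ _)
  · exact absurd (e.symm.trans e') (h.E_ne_a₀ _ _)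
  · rw [same (h.E_inj _ _ (e.symm.trans e'))]

/-- Every chord end of the next seed lies in layer 2 or 3. -/
theorem next_off_of_low {x : V} {z : Fin 4} (hz : z = 0 ∨ z = 1) : S.next.OffChords (x, z) := by
  intro k hk
  obtain ⟨j, -, hv⟩ := h.next_chordEnd_cases hk
  rcases hz with rfl | rfl <;> simp at hv

theorem next_off_d₂ {j : Option (Option (Option R))} (hj : j ≠ some none) :
    S.next.OffChords (S.next.d₂ j) := by
  intro k hk
  rw [h.next_d₂ hj] at hk
  obtain ⟨j', -, hv⟩ := h.next_chordEnd_cases hk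
  rcases hv with ⟨e, -, -⟩ | ⟨-, e, -⟩ | ⟨-, e, -⟩
  · exact h.a_ne_a₀ _ _ e.symm
  · simp at e
  · simp at e

theorem next_off_YD {j : Option (Option (Option R))} (hj : j ≠ some none)
    (k : SeedColor (Option R)) (hk : k = one ∨ k = two) :
    S.next.OffChords (S.next.Y k (S.next.D j)) := by
  rcases hk with rfl | rfl
  · intro k hk
    rw [h.next_YD_one hj] at hk
    obtain ⟨j', -, hv⟩ := h.next_chordEnd_cases hk
    have hp : S.par (S.Y two (S.E (site j))) = true := by rw [h.par_Y, h.par_E]; rfl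
    rcases hv with ⟨e, -, -⟩ | ⟨e, -, -⟩ | ⟨e, -, -⟩ <;> simp only at e
    · rw [e, h.par_a] at hp; cases hp
    · exact h.E_ne_a (site j) (site j') (by
        rw [← h.Y_Y two (S.E (site j)), ← h.Y_Y two (S.a (site j'))]; exact congrArg _ e)
    · rw [e, h.par_E] at hp; cases hp
  · rw [h.next_YD_two hj]
    exact h.next_off_of_low (Or.inl rfl)

theorem next_a_inj (j j' : Option (Option (Option R))) (e : S.next.a j = S.next.a j') : j = j' := by
  by_cases hj : j = some none
  · by_cases hj' : j' = some none
    · rw [hj, hj']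
    · rw [hj, S.next_a hj'] at e
      exact absurd (congrArg Prod.snd e) (by simp [next])
  · by_cases hj' : j' = some none
    · rw [hj', S.next_a hj] at e
      exact absurd (congrArg Prod.snd e) (by simp [next])
    · rw [S.next_a hj, S.next_a hj'] at e
      exact site_injective hj hj' (h.a_inj _ _ (congrArg Prod.fst e))

theorem next_E_inj (j j' : Option (Option (Option R))) (e : S.next.E j = S.next.E j') : j = j' := by
  rcases j with _ | _ | j <;> rcases j' with _ | _ | j' <;>
    simp only [h.next_E_none, h.next_E_spare, h.next_E_some, Prod.mk.injEq] at e
  · rfl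
  · simp at e
  · simp at e
  · simp at e
  · rfl
  · simp at e
  · simp at e
  · simp at e
  · rw [h.F_inj _ _ e.1]

theorem next_E_ne_a (j j' : Option (Option (Option R))) : S.next.E j ≠ S.next.a j' := by
  intro e
  have h1 : S.next.a (some none) = (S.a (some none), 1) := rfl
  rcases j with _ | _ | j <;> rcases j' with _ | _ | j' <;>
    simp only [h.next_E_none, h.next_E_spare, h.next_E_some, h1, S.next_a (j := none) (by simp),
      S.next_a (j := some (some _)) (by simp), Prod.mk.injEq] at e
  · simp at e
  · have := h.a_inj _ _ e.1
    cases this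
  all_goals simp at e

theorem next_F_inj (r r' : Option (Option R)) (e : S.next.F (some r) = S.next.F (some r')) :
    r = r' := by
  rcases r with _ | r <;> rcases r' with _ | r' <;>
    simp only [h.next_F_spare, h.next_F_some, Prod.mk.injEq] at e
  · rfl
  · simp at e
  · simp at e
  · rw [h.F_inj _ _ e.1]

theorem next_isChordEnd_solo (v : V × Fin 4) : S.next.IsChordEnd v solo ↔
    (v = (S.a none, 3) ∨ v = (S.a none, 2)) ∨ (v = (S.a₀ none, 3) ∨ v = (S.E none, 3)) := by
  rw [SeedData.isChordEnd_solo, S.next_a (j := none) (by simp), h.next_b (j := none) (by simp),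
    S.next_d (j := none) (by simp), h.next_D (j := none) (by simp)]
  rfl

open Classical in
theorem next_Z_solo (x : V) (z : Fin 4) : S.next.Z solo (x, z) =
    if S.IsChordEnd x solo then (x, squareFlip (S.par x) z) else (S.Z solo x, z) := by
  change S.nextA (.inl solo) _ = _
  split_ifs with hx
  · rw [h.nextA_inl_chord hx]; simp [column]
  · exact h.nextA_inl_of_ne hx (by simp) (by simp) z

omit h in
theorem next_Y_solo (x : V) (z : Fin 4) : S.next.Y solo (x, z) =
    ((if z = 0 then S.Y' else S.Y) solo x, z) := by
  change S.nextB S.Y' (.inl solo) _ = _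
  by_cases hz : z = 0 <;> simp [nextB, hz, SeedColor.swap]

theorem P_E : S.P (S.E none) = false := by
  change S.P (S.Z solo (S.a₀ none)) = false
  rw [h.P_Z _ (h.off_a₀ none (by simp) _), h.P_a₀]

theorem next_P_Y (v : V × Fin 4) : S.next.P (S.next.Y solo v) = S.next.P v := by
  obtain ⟨x, z⟩ := v
  rw [next_Y_solo]
  fin_cases z <;> simp [next, h.P_Y, h.T_Y, h.W_Y']

theorem next_T_Y (v : V × Fin 4) : S.next.T (S.next.Y solo v) = S.next.T v := by
  obtain ⟨x, z⟩ := v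
  rw [next_Y_solo]
  fin_cases z <;> simp [next, h.P_Y, h.T_Y, h.W_Y']

theorem next_P_Z (v : V × Fin 4) (hv : ¬ S.next.IsChordEnd v solo) :
    S.next.P (S.next.Z solo v) = S.next.P v := by
  obtain ⟨x, z⟩ := v
  rw [h.next_isChordEnd_solo] at hv
  rw [h.next_Z_solo]
  split_ifs with hx
  · obtain (rfl | rfl) | (rfl | rfl) := (S.isChordEnd_solo x).1 hx <;> fin_cases z <;>
      simp_all [next, squareFlip, h.par_a, h.par_b, h.par_d, h.par_D, h.W_a, h.W_b, h.W_d, h.W_D,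
        h.P_a, h.P_b, h.P_d, h.P_D, h.T_b, h.T_D]
  · fin_cases z
    · simp [next, h.W_Z]
    · simp [next, h.P_Z x hx]
    · simp [next, h.P_Z x hx]
    · simp [next, h.P_Z x hx, h.T_Z x hx (by rintro rfl; simp at hv) (by rintro rfl; simp at hv)]

theorem next_T_Z (v : V × Fin 4) (hv : ¬ S.next.IsChordEnd v solo) (h1 : v ≠ S.next.a₀ none)
    (h2 : v ≠ S.next.E none) : S.next.T (S.next.Z solo v) = S.next.T v := by
  obtain ⟨x, z⟩ := v
  rw [h.next_isChordEnd_solo] at hv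
  rw [h.next_a₀ (by simp)] at h1
  rw [h.next_E_none] at h2
  change _ ≠ (S.a none, 0) at h1
  rw [h.next_Z_solo]
  split_ifs with hx
  · obtain (rfl | rfl) | (rfl | rfl) := (S.isChordEnd_solo x).1 hx <;> fin_cases z <;>
      simp_all [next, squareFlip, h.par_b, h.par_d, h.par_D, h.W_b, h.W_d, h.W_D,
        h.P_b, h.P_d, h.P_D, h.T_b, h.T_D]
  · fin_cases z
    · simp [next, h.W_Z]
    · simp [next]
    · simp [next]
    · simp [next, h.P_Z x hx, h.T_Z x hx (by rintro rfl; simp at hv) (by rintro rfl; simp at hv)]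

theorem next_par_adj (v w : V × Fin 4) (hvw : (nextGraph G).Adj v w) :
    S.next.par w = !S.next.par v := by
  obtain ⟨x, z⟩ := v
  obtain ⟨y, w⟩ := w
  rw [SimpleGraph.boxProd_adj] at hvw
  rcases hvw with ⟨ha, hz⟩ | ⟨⟨d, hd⟩, hx⟩
  · simp only at ha hz
    subst hz
    simp [next, h.par_adj _ _ ha]
  · simp only at hx hd
    subst hx hd
    cases d <;> fin_cases z <;> simp [next, squareFlip]

/-- The new color pairs the damaged column color with a layer color; an inherited color is held
together by its own chord. -/
theorem next_trans_left [Finite V] {Q : SeedColor R → V → V} (hQ : IsFactoring G Q)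
    (hQ2 : ∀ x, Q two x = S.Y two x)
    (hZQ : ∀ r, JointlyTransitive (S.Z (left r)) (Q (left r))) (r : Option R) :
    JointlyTransitive (S.nextA (nextLeft (left r))) (S.nextB Q (nextRight (left r))) := by
  rcases r with _ | r
  · exact h.trans_chords hQ2
  · exact h.trans_link (k := left r) (by simp) (by simp) (h.chord (some (some r)) (by simp))
      (fun x => S.isChordEnd_left x r) hQ (h.trans_ZY _) (hZQ r)

theorem next_trans_right [Finite V] {Q : SeedColor R → V → V} (hQ : IsFactoring G Q)
    (hZQ : ∀ r, JointlyTransitive (S.Z (right r)) (Q (right r))) (r : Option R) :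
    JointlyTransitive (S.nextA (nextLeft (right r))) (S.nextB Q (nextRight (right r))) := by
  rcases r with _ | r
  · exact h.trans_two_column false fun _ _ => rfl
  · exact h.trans_link (by simp) (by simp) (u := S.d (some (some r))) rfl
      (fun x => S.isChordEnd_right x r) hQ (h.trans_ZY _) (hZQ r)

/-- The recursion step for seeds. -/
theorem next [Finite V] : S.next.IsSeed (nextGraph G) where
  par_adj := h.next_par_adj
  factoring_Z := h.nextA_isFactoring.reindex nextLeft
  factoring_Y := (h.nextB_isFactoring h.factoring_Y').reindex nextRight
  factoring_Y' := (h.nextB_isFactoring h.factoring_Y).reindex nextRight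
  trans_ZY
    | one => (h.trans_nextB_two_column h.trans_Y'Y true h.nextA_inr_true).symm
    | two => h.trans_one_column true fun _ _ => rfl
    | solo => h.trans_solo
    | left r => h.next_trans_left h.factoring_Y' h.Y'_two h.trans_left r
    | right r => h.next_trans_right h.factoring_Y' h.trans_right r
  trans_left := h.next_trans_left h.factoring_Y (fun _ => rfl) fun _ => h.trans_ZY _
  trans_right := h.next_trans_right h.factoring_Y fun _ => h.trans_ZY _
  trans_ZZ := (h.trans_one_column true h.nextA_inr_true).symm
  trans_YY := h.trans_nextB_two_column h.trans_Y'Y true fun _ _ => rfl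
  trans_Y'Y := h.trans_nextB_two_column h.trans_YY true fun _ _ => rfl
  Y'_two _ := rfl
  par_a
    | none => by simp [SeedData.next, h.par_a]
    | some none => by simp [SeedData.next, h.par_a]
    | some (some r) => by simp [SeedData.next, h.par_a]
  chord _ := h.next_chord
  chordEnd_unique := h.next_chordEnd_unique
  off_a₀ j hj := by rw [h.next_a₀ hj]; exact h.next_off_of_low (Or.inl rfl)
  off_b₀ j hj := by rw [h.next_b₀ hj]; exact h.next_off_of_low (Or.inr rfl)
  off_d₂ _ := h.next_off_d₂
  off_YD _ hj k := h.next_off_YD hj k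
  off_spare := h.next_off_of_low (Or.inr rfl)
  a_inj := h.next_a_inj
  E_inj := h.next_E_inj
  E_ne_a := h.next_E_ne_a
  F_inj := h.next_F_inj
  W_Z v := by
    obtain ⟨x, z⟩ := v
    rw [h.next_Z_solo]
    split_ifs with hx
    · rfl
    · exact h.P_Z x hx
  W_Y' v := by
    change S.P (S.nextB S.Y (.inl solo) v).1 = S.P v.1
    by_cases hz : v.2 = 0 <;> simp [nextB, hz, SeedColor.swap, h.P_Y]
  W_a := by rw [S.next_a (by simp)]; exact h.P_a
  W_d := by rw [S.next_d (by simp)]; exact h.P_a₀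
  W_orbit φ h1 h2 := h.solo_orbit h1 h2
  P_Y := h.next_P_Y
  P_Z := h.next_P_Z
  P_a := by rw [S.next_a (by simp)]; simp [SeedData.next, site, h.P_a]
  P_d := by rw [S.next_d (by simp)]; simp [SeedData.next, site, h.T_a₀]
  P_b := by rw [h.next_b (by simp)]; simp [SeedData.next, site, h.P_a]
  P_D := by rw [h.next_D (by simp)]; simp [SeedData.next, site, h.P_E, h.T_E]
  P_a₀ := by rw [h.next_a₀ (by simp)]; simp [SeedData.next, site, h.W_a]
  T_Y := h.next_T_Y
  T_Z := h.next_T_Z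
  T_D := by rw [h.next_D (by simp)]; simp [SeedData.next, site, h.P_E, h.T_E]
  T_a₀ := by rw [h.next_a₀ (by simp)]; simp [SeedData.next, site, h.W_a]
  T_b := by rw [h.next_b (by simp)]; simp [SeedData.next]
  T_E := by rw [h.next_E_none]; simp [SeedData.next]

end IsSeed

end SeedData

/-! ### From seeds to hypercubes; matchings stored as tables -/

/-- Some seed lives on the hypercube of dimension `n`. -/
def HasSeed (n : ℕ) : Prop :=
  ∃ (V R : Type) (_ : Finite V) (_ : Fintype R) (G : SimpleGraph V) (S : SeedData V R),
    S.IsSeed G ∧ Nonempty (G ≃g hypercube n) ∧ 2 * Fintype.card R + 3 = n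

theorem HasSeed.next {n : ℕ} (h : HasSeed n) : HasSeed (n + 2) := by
  obtain ⟨V, R, _, _, G, S, hS, ⟨e⟩, hn⟩ := h
  exact ⟨V × Fin 4, Option R, inferInstance, inferInstance, _, S.next, hS.next,
    ⟨(boxProdIso e squareIso).trans (hypercubeSumIso n 2)⟩, by rw [Fintype.card_option]; omega⟩

theorem HasSeed.hypercubePair {n : ℕ} (h : HasSeed n) : HypercubePair n := by
  obtain ⟨V, R, _, _, G, S, hS, ⟨e⟩, hn⟩ := h
  exact .of_iso ⟨S.Z, S.Y, hS.factoring_Z, hS.factoring_Y, hS.trans_ZY⟩ e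
    (by rw [SeedColor.card_eq, hn])

/-- A self-map of `Fin n` read off the base-`2 ^ w` digits of a number. -/
def tableMap (w : ℕ) {n : ℕ} [NeZero n] (M : ℕ) (v : Fin n) : Fin n :=
  -- `Fin.ofNat` reduces modulo `n`, so for `n = 2 ^ w` exactly the lowest `w` bits of the shifted
  -- number remain.
  Fin.ofNat n (M >>> (w * v.val))

/-- Toggling a binary digit. -/
def bitFlip {n d : ℕ} [NeZero n] (i : Fin d) (v : Fin n) : Fin n :=
  Fin.ofNat n (v.val ^^^ 2 ^ i.val)

/-- The binary digits of a number. -/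
def bitSet {n : ℕ} (d : ℕ) (v : Fin n) : Finset (Fin d) :=
  Finset.univ.filter fun i => v.val.testBit i.val

/-- A family of `d` involutions moving along a flip graph of degree `d` is a factoring. -/
theorem isFactoring_of_moves {V C : Type*} [Fintype C] {d : ℕ} {flip : Fin d → V → V}
    {hne : ∀ i v, flip i v ≠ v} {hinv : ∀ i v, flip i (flip i v) = v}
    (hd : Fintype.card C = d) {f : C → V → V} (hf : ∀ c v, f c (f c v) = v)
    (hinj : ∀ v c c', f c v = f c' v → c = c') (hmove : ∀ c v, ∃ i, flip i v = f c v) :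
    IsFactoring (flipGraph flip hne hinv) f where
  invol := hf
  adj_iff v w := by
    choose g hg using fun c => hmove c v
    have hgi : Function.Injective g := fun c c' e => hinj v c c' (by rw [← hg, ← hg, e])
    have hgs := ((Fintype.bijective_iff_injective_and_card g).2 ⟨hgi, by simp [hd]⟩).2
    constructor
    · rintro ⟨i, hi⟩
      obtain ⟨c, rfl⟩ := hgs i
      exact ⟨c, by rw [← hg, hi]⟩
    · rintro ⟨c, hc⟩
      exact ⟨g c, by rw [hg, hc]⟩
  inj c d v h := hinj v c d h

theorem bitFlip_ne_32 : ∀ (i : Fin 5) (v : Fin 32), bitFlip i v ≠ v := by decide +kernel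

theorem bitFlip_bitFlip_32 : ∀ (i : Fin 5) (v : Fin 32), bitFlip i (bitFlip i v) = v := by
  decide +kernel

theorem bitFlip_ne_64 : ∀ (i : Fin 6) (v : Fin 64), bitFlip i v ≠ v := by decide +kernel

theorem bitFlip_bitFlip_64 : ∀ (i : Fin 6) (v : Fin 64), bitFlip i (bitFlip i v) = v := by
  decide +kernel

theorem bitSet_bijective {n d : ℕ} (hn : n = 2 ^ d) :
    Function.Bijective (bitSet d : Fin n → Finset (Fin d)) := by
  subst hn
  rw [Fintype.bijective_iff_injective_and_card]
  refine ⟨fun v w h => ?_, by simp⟩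
  refine Fin.ext (Nat.eq_of_testBit_eq fun i => ?_)
  by_cases hi : i < d
  · have := Finset.ext_iff.1 h ⟨i, hi⟩
    simp only [bitSet, Finset.mem_filter, Finset.mem_univ, true_and] at this
    exact Bool.eq_iff_iff.2 this
  · have hle : 2 ^ d ≤ 2 ^ i := Nat.pow_le_pow_right (by simp) (not_lt.1 hi)
    rw [Nat.testBit_lt_two_pow (v.2.trans_le hle), Nat.testBit_lt_two_pow (w.2.trans_le hle)]

theorem bitSet_bitFlip_32 : ∀ (i : Fin 5) (v : Fin 32),
    bitSet 5 (bitFlip i v) = symmDiff (bitSet 5 v) {i} := by decide +kernel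

theorem bitSet_bitFlip_64 : ∀ (i : Fin 6) (v : Fin 64),
    bitSet 6 (bitFlip i v) = symmDiff (bitSet 6 v) {i} := by decide +kernel

/-! ### The base seed in dimension five -/

/-- The first factorization of the base seed. -/
def baseZ : SeedColor Unit → Fin 32 → Fin 32
  | .one => tableMap 5 0xdf2befe13a99bb0b883473d8d1a32a2d8e05ca24
  | .two => tableMap 5 0xebbf49ab19b5e3cdc2b25f8a47e820189ac39928
  | .left _ => tableMap 5 0xbd9acd6e30ff8a494f3839bbc52d097bab410c01
  | .right _ => tableMap 5 0xf7f9dccb68ad2f68ea606b1ee4897831c850a870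
  | .solo => tableMap 5 0x7eb385fbbc3ca951da11fa928db9acb9026980a2

/-- The second factorization of the base seed. -/
def baseY : SeedColor Unit → Fin 32 → Fin 32
  | .one => tableMap 5 0x7bb2cd6fb03d23694eb8ff8bc52d09b91a610c01
  | .two => tableMap 5 0xbdb9d5e13aff8b088a7473d8dda32a31ea00c864
  | .left _ => tableMap 5 0xeebf8cfb7cb5e951c0326a9e44b960288ec99a28
  | .right _ => tableMap 5 0xdf2befab199cba4bda11399281e9ac7b834580a2
  | .solo => tableMap 5 0xf7db49ca28a9afcdeb205b3ae788381d8853a930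

/-- The third factorization of the base seed. -/
def baseY' : SeedColor Unit → Fin 32 → Fin 32
  | .one => tableMap 5 0xebbec9aa303ca95ddb385f8bc7e909b91a610c01
  | .two => tableMap 5 0xbdb9d5e13aff8b088a7473d8dda32a31ea00c864
  | .left _ => tableMap 5 0xdeb38ffbbcad2f61c0326a9e44b960288ec99a28
  | .right _ => tableMap 5 0x7f2bed6f19b5fa494e11f992852dac1b834380a2
  | .solo => tableMap 5 0xf7db4ccb6899a3cbeaa03b3ae188387d8855a930

/-- The base seed, on the five-dimensional hypercube. -/
def baseSeed : SeedData (Fin 32) Unit where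
  par v := (List.range 5).foldl (fun p i => xor p (v.val.testBit i)) false
  Z := baseZ
  Y := baseY
  Y' := baseY'
  a
    | none => 0
    | some none => 29
    | some (some _) => 15
  W v := Nat.testBit 0x11335505 v.val
  P v := Nat.testBit 0x22032203 v.val
  T v := Nat.testBit 0x30 v.val

instance (x : Fin 32) (k : SeedColor Unit) : Decidable (baseSeed.IsChordEnd x k) := by
  unfold SeedData.IsChordEnd
  infer_instance

instance (x : Fin 32) : Decidable (baseSeed.OffChords x) := by
  unfold SeedData.OffChords
  infer_instance

/-- The five-dimensional hypercube on binary numbers. -/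
abbrev bitCube : SimpleGraph (Fin 32) :=
  flipGraph (bitFlip (d := 5)) bitFlip_ne_32 bitFlip_bitFlip_32

open SeedColor in
theorem baseSeed_isSeed : baseSeed.IsSeed bitCube where
  par_adj := by
    have : ∀ (i : Fin 5) (v : Fin 32), baseSeed.par (bitFlip i v) = !baseSeed.par v := by
      decide +kernel
    rintro v _ ⟨i, rfl⟩
    exact this i v
  factoring_Z := isFactoring_of_moves rfl (by decide +kernel) (by decide +kernel)
    (by decide +kernel)
  factoring_Y := isFactoring_of_moves rfl (by decide +kernel) (by decide +kernel)
    (by decide +kernel)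
  factoring_Y' := isFactoring_of_moves rfl (by decide +kernel) (by decide +kernel)
    (by decide +kernel)
  trans_ZY x := jointlyTransitive_of_alternatingWalk 16 0 (by revert x; decide +kernel)
  trans_left r := jointlyTransitive_of_alternatingWalk 16 0 (by revert r; decide +kernel)
  trans_right r := jointlyTransitive_of_alternatingWalk 16 0 (by revert r; decide +kernel)
  trans_ZZ := jointlyTransitive_of_alternatingWalk 16 0 (by decide +kernel)
  trans_YY := jointlyTransitive_of_alternatingWalk 16 0 (by decide +kernel)
  trans_Y'Y := jointlyTransitive_of_alternatingWalk 16 0 (by decide +kernel)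
  Y'_two _ := rfl
  par_a := by decide +kernel
  chord := by decide +kernel
  chordEnd_unique := by decide +kernel
  off_a₀ := by decide +kernel
  off_b₀ := by decide +kernel
  off_d₂ := by decide +kernel
  off_YD := by decide +kernel
  off_spare := by decide +kernel
  a_inj := by decide +kernel
  E_inj := by decide +kernel
  E_ne_a := by decide +kernel
  F_inj := by decide +kernel
  W_Z := by decide +kernel
  W_Y' := by decide +kernel
  W_a := by decide +kernel
  W_d := by decide +kernel
  W_orbit := by
    have h1 : ∀ x, baseSeed.W x = true → x ∈ alternatingWalk (baseSeed.Z solo) (baseSeed.Y' solo)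
      16 0 := by decide +kernel
    have h2 : ∀ x, baseSeed.W x = false → x ∈ alternatingWalk (baseSeed.Z solo) (baseSeed.Y' solo)
      16 1 := by decide +kernel
    intro φ hZ hY x y hxy
    cases hx : baseSeed.W x
    · exact (eq_of_mem_alternatingWalk hZ hY _ _ _ (h2 x hx)).trans
        (eq_of_mem_alternatingWalk hZ hY _ _ _ (h2 y (hxy ▸ hx))).symm
    · exact (eq_of_mem_alternatingWalk hZ hY _ _ _ (h1 x hx)).trans
        (eq_of_mem_alternatingWalk hZ hY _ _ _ (h1 y (hxy ▸ hx))).symm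
  P_Y := by decide +kernel
  P_Z := by decide +kernel
  P_a := by decide +kernel
  P_d := by decide +kernel
  P_b := by decide +kernel
  P_D := by decide +kernel
  P_a₀ := by decide +kernel
  T_Y := by decide +kernel
  T_Z := by decide +kernel
  T_D := by decide +kernel
  T_a₀ := by decide +kernel
  T_b := by decide +kernel
  T_E := by decide +kernel

theorem hasSeed_five : HasSeed 5 :=
  ⟨Fin 32, Unit, inferInstance, inferInstance, _, baseSeed, baseSeed_isSeed,
    ⟨flipGraphIso _ _ _ (Equiv.ofBijective _ (bitSet_bijective (d := 5) rfl)) bitSet_bitFlip_32⟩,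
    rfl⟩

theorem hasSeed_odd (m : ℕ) : HasSeed (2 * m + 5) := by
  induction m with
  | zero => exact hasSeed_five
  | succ m ih => exact ih.next

/-! ### Connected pairs in all dimensions except three -/

/-- Cyclic rotation of six binary digits. -/
def rotateSix (k : ℕ) (v : Fin 64) : Fin 64 :=
  Fin.ofNat 64 ((v.val <<< k) ||| (v.val >>> (6 - k)))

/-- A matching of the six-dimensional hypercube whose rotations form a factorization. -/
def sixA : Fin 64 → Fin 64 := tableMap 6 0xf5efdcaf8a7ad56de48f08723ec36eecae609629f4ce6c686fe57c7d845a4f67445c2640bc6b4826a2cc14e1d40520d0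

/-- Another such matching. -/
def sixB : Fin 64 → Fin 64 := tableMap 6 0xfbff3debbe39db7d35cb3c31bafb2daaba299a79258a382179f71d69b61959751549341138f30d28b209187105083001

/-- Conjugates by rotation. -/
def rotations (f : Fin 64 → Fin 64) (i : Fin 6) (v : Fin 64) : Fin 64 :=
  rotateSix i (f (rotateSix (6 - i) v))

theorem hypercubePair_six : HypercubePair 6 := by
  refine HypercubePair.of_iso (G := flipGraph (bitFlip (d := 6)) bitFlip_ne_64 bitFlip_bitFlip_64)
    (C := Fin 6) ⟨rotations sixA, rotations sixB,
      isFactoring_of_moves rfl (by decide +kernel) (by decide +kernel) (by decide +kernel),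
      isFactoring_of_moves rfl (by decide +kernel) (by decide +kernel) (by decide +kernel),
      fun c => jointlyTransitive_of_alternatingWalk 32 0 (by revert c; decide +kernel)⟩
    (flipGraphIso _ _ _ (Equiv.ofBijective _ (bitSet_bijective (d := 6) rfl)) bitSet_bitFlip_64) rfl

theorem hypercubePair_one : HypercubePair 1 := by
  have hf : IsFactoring (hypercube 1) (fun i s => symmDiff s {i}) :=
    { invol := fun i s => symmDiff_symmDiff_cancel_right _ _
      adj_iff := hypercube_adj_iff
      inj := fun _ _ _ _ => Subsingleton.elim _ _ }
  exact ⟨_, _, hf, hf, fun c => jointlyTransitive_of_alternatingWalk 1 ∅ (by revert c; decide)⟩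

theorem hypercubePair_of_ne_three (n : ℕ) (hn : 1 ≤ n) (h3 : n ≠ 3) : HypercubePair n := by
  induction n using Nat.strong_induction_on with
  | _ n ih =>
    rcases Nat.even_or_odd' n with ⟨k, rfl | rfl⟩
    -- Doubling fails for `6` because its half is the missing dimension `3`.
    · by_cases hk : k = 3
      · subst hk; exact hypercubePair_six
      · rw [two_mul]
        exact (ih k (by omega) (by omega) hk).double
    · rcases k with _ | _ | k
      · exact hypercubePair_one
      · omega
      · exact (hasSeed_odd k).hypercubePair

/-! ### Crossing factorizations with a three-dimensional side -/

/-- Toggling one of three bits. -/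
def cubeFlip : Fin 3 → Bool × Bool × Bool → Bool × Bool × Bool
  | 0, (p, q, r) => (!p, q, r)
  | 1, (p, q, r) => (p, !q, r)
  | 2, (p, q, r) => (p, q, !r)

theorem cubeFlip_ne (i : Fin 3) (v : Bool × Bool × Bool) : cubeFlip i v ≠ v := by
  revert i v; decide

theorem cubeFlip_flip (i : Fin 3) (v : Bool × Bool × Bool) : cubeFlip i (cubeFlip i v) = v := by
  revert i v; decide

theorem cubeFlip_inj (i j : Fin 3) (v : Bool × Bool × Bool) (h : cubeFlip i v = cubeFlip j v) :
    i = j := by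
  revert i j v; decide

/-- The three-dimensional cube. -/
def cube : SimpleGraph (Bool × Bool × Bool) := flipGraph cubeFlip cubeFlip_ne cubeFlip_flip

/-- The three-dimensional cube is a hypercube. -/
def cubeIso : cube ≃g hypercube 3 :=
  flipGraphIso _ _ _ ⟨fun v => Finset.univ.filter fun i => ![v.1, v.2.1, v.2.2] i = true,
    fun s => (decide (0 ∈ s), decide (1 ∈ s), decide (2 ∈ s)), by decide, by decide⟩ (by decide)

/-- Whether exactly one of three bits is set. -/
def isUnit (v : Bool × Bool × Bool) : Bool :=
  v = (true, false, false) || v = (false, true, false) || v = (false, false, true)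

/-- A function on the cube times `W` invariant along one factor of each kind is constant. -/
theorem eq_of_cube_invariant {W : Type*} [Finite W] {A B : W → W} (hA : ∀ y, A (A y) = y)
    (hA' : ∀ y, A y ≠ y) (hB : ∀ y, B (B y) = y) (hB' : ∀ y, B y ≠ y)
    (hAB : JointlyTransitive A B) (par : W → Bool) (hpar : ∀ y, par (B y) = !par y)
    (hodd : ∃ g : W → W, (∀ y, g (g y) = y) ∧ (∀ y, g y ≠ y) ∧ ∀ y, par (g y) = par y)
    (y₁ : W) (hy₁ : par y₁ = false) (s : Bool → Bool → Bool → W → Bool)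
    (hs : ∀ p q r y, s p q r ((if isUnit (p, q, r) then A else B) y) = s p q r y)
    (he : ∀ p q r y, par y = false → y ≠ y₁ → s (!p) q r y = s p q r y)
    (ho : ∀ p q r y, par y = true → s p (!q) r y = s p q r y)
    (h1 : ∀ p q r, s p q (!r) y₁ = s p q r y₁) (p q r p' q' r' : Bool) (y y' : W) :
    s p q r y = s p' q' r' y' := by
  have i000 := hs false false false
  have i100 := hs true false false
  have i010 := hs false true false
  have i001 := hs false false true
  have i110 := hs true true false
  have i101 := hs true false true
  have i011 := hs false true true
  have i111 := hs true true true
  simp only [isUnit, Prod.mk.injEq, Bool.false_eq_true, Bool.true_eq_false, and_true, and_false,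
    decide_false, decide_true, Bool.or_false, Bool.or_true, if_true, if_false, and_self]
    at i000 i100 i010 i001 i110 i101 i011 i111
  -- Over odd `y` the second bit may be toggled. Both columns carry `B`, which changes the parity of
  -- `y`, so the equality moves to even `y`.
  have hY : ∀ y, s true false true y = s true true true y := fun y => by
    cases hp : par y
    · rw [← i101, ← i111]
      exact (ho true false true (B y) (by rw [hpar, hp]; rfl)).symm
    · exact (ho true false true y hp).symm
  -- One column carries `A` and the other `B`, and they agree off `y₁`; parity makes them equal,
  -- hence constant.
  have hε : s false false true = s false true true :=
    eq_of_invariant_of_eq_off hA hA' hB hB' i001 i011 y₁ fun y hy => by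
      cases hp : par y
      · exact (he false false true y hp hy).symm.trans ((hY y).trans (he false true true y hp hy))
      · exact (ho false false true y hp).symm
  have hεc : ∀ y y', s false false true y = s false false true y' :=
    hAB _ i001 (hε ▸ i011)
  have huv : ∀ y, xor (s false false false y) (s true true false y) =
      xor (s true false false y) (s false true false y) := fun y => by
    cases hp : par y
    · by_cases hy : y = y₁
      · subst hy
        have e1 := h1 false false false
        have e2 := h1 true true false
        have e3 := h1 true false false
        have e4 := h1 false true false
        have e5 := hY y
        have e6 := congrFun hε y
        simp only [Bool.not_false] at e1 e2 e3 e4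
        rw [← e1, ← e2, ← e3, ← e4, e5, e6, Bool.xor_comm]
      · have e1 := he false false false y hp hy
        have e2 := he false true false y hp hy
        simp only [Bool.not_false] at e1 e2
        rw [e1, e2]
    · have e1 := ho false false false y hp
      have e2 := ho true false false y hp
      simp only [Bool.not_false] at e1 e2
      rw [e1, e2, Bool.xor_comm]
  -- The columns `000` and `110` carry `B`, while `100` and `010` carry `A`. By `huv` the two sums
  -- coincide, so this one is invariant under both.
  have hκ : ∀ y y', xor (s false false false y) (s true true false y) =
      xor (s false false false y') (s true true false y') :=
    hAB (fun y => xor (s false false false y) (s true true false y))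
      (fun y => by simp only [huv, i100, i010]) (fun y => by simp only [i000, i110])
  have hY1 : s true true true y₁ = s true true false y₁ := h1 true true false
  have hE1 : s false false true y₁ = s false false false y₁ := h1 false false false
  have hE2 : s false true true y₁ = s false true false y₁ := h1 false true false
  have hY2 : s true false true y₁ = s true false false y₁ := h1 true false false
  cases hk : xor (s false false false y₁) (s true true false y₁)
  · have hu : ∀ y, s false false false y = s true true false y := fun y => by
      have := (hκ y y₁).trans hk
      revert this
      cases s false false false y <;> cases s true true false y <;> simp
    have hv : ∀ y, s true false false y = s false true false y := fun y => by
      have := (huv y).symm.trans ((hκ y y₁).trans hk)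
      revert this
      cases s true false false y <;> cases s false true false y <;> simp
    have h4 : ∀ y, s false false false y = s true false false y := fun y => by
      cases hp : par y
      · by_cases hy : y = y₁
        · subst hy
          rw [hv, ← hE2, ← congrFun hε y, hE1]
        · exact (he false false false y hp hy).symm
      · rw [hv]; exact (ho false false false y hp).symm
    have h0 : ∀ y y', s false false false y = s false false false y' :=
      hAB _ (fun y => by rw [h4, h4, i100]) i000
    have hYε : ∀ y, s true true true y = s false false true y := fun y => by
      have hy₁ : s true true true y₁ = s false false true y₁ := by rw [hY1, hE1, hu]
      have heven : ∀ y, par y = false → s true true true y = s false false true y := fun y hp => by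
        by_cases hy : y = y₁
        · rw [hy, hy₁]
        · rw [← hY]; exact he false false true y hp hy
      cases hp : par y
      · exact heven y hp
      · rw [← i111, heven (B y) (by rw [hpar, hp]; rfl)]
        exact hεc _ _
    have hall : ∀ p q r y, s p q r y = s false false false y₁ := fun p q r y => by
      cases p <;> cases q <;> cases r
      · exact h0 _ _
      · rw [hεc y y₁, hE1]
      · rw [← hv, ← h4]; exact h0 _ _
      · rw [← congrFun hε y, hεc y y₁, hE1]
      · rw [← h4]; exact h0 _ _
      · rw [hY, hYε, hεc y y₁, hE1]
      · rw [← hu]; exact h0 _ _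
      · rw [hYε, hεc y y₁, hE1]
    rw [hall, hall p']
  · exfalso
    have := Fintype.ofFinite W
    classical
    have hu : ∀ y, s true true false y = !s false false false y := fun y => by
      have := (hκ y y₁).trans hk
      revert this
      cases s false false false y <;> cases s true true false y <;> simp
    have hv : ∀ y, s true false false y = !s false true false y := fun y => by
      have := (huv y).symm.trans ((hκ y y₁).trans hk)
      revert this
      cases s true false false y <;> cases s false true false y <;> simp
    obtain ⟨g, hg, hg', hgp⟩ := hodd
    have s0 := sum_eq_zero_of_involution hB hB' i000
    have s1 := sum_eq_zero_of_involution hA hA' i100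
    have s2 := sum_eq_zero_of_involution hg hg' hgp
    -- If the sum is `true`, the columns `000` and `100` differ exactly at the odd vertices and at
    -- `y₁`. That is an odd number of places, as `hodd` makes the odd vertices even in number, yet
    -- both columns have even size.
    have hsum : ∑ y, (if s false false false y then (1 : ZMod 2) else 0) =
        ∑ y, ((if s true false false y then (1 : ZMod 2) else 0) + (if par y then 1 else 0) +
          if y = y₁ then 1 else 0) := by
      refine Finset.sum_congr rfl fun y _ => ?_
      cases hp : par y
      · by_cases hy : y = y₁
        · subst hy
          have e : s true false false y = !s false false false y := by
            rw [← hY2, hY, hY1, hu]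
          rw [e]
          cases s false false false y <;> (simp; try rfl)
        · rw [show s true false false y = s false false false y from he false false false y hp hy]
          simp [hy]
      · have hy : y ≠ y₁ := fun e => by rw [e, hy₁] at hp; cases hp
        have e : s false true false y = s false false false y := ho false false false y hp
        rw [hv, e]
        cases s false false false y <;> (simp [hy]; try rfl)
    rw [Finset.sum_add_distrib, Finset.sum_add_distrib, s0, s1, s2] at hsum
    simp at hsum

/-- The three directions of the cube are shifted cyclically by 0 over even `y`, by 1 over odd `y`
and by 2 over one even vertex `y₁`; columns use `A` over the unit vertices and `B` elsewhere. Cyclic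
rotation of the bits preserves the unit vertices, so all three colors reduce to the first. -/
theorem HasConnectedPair.cube_hasCrossing {W D : Type*} [Finite W] {H : SimpleGraph W}
    (par : W → Bool) (hpar : ∀ v w, H.Adj v w → par w = !par v)
    (hodd : ∃ g : W → W, (∀ y, g (g y) = y) ∧ (∀ y, g y ≠ y) ∧ ∀ y, par (g y) = par y)
    (y₁ : W) (hy₁ : par y₁ = false) (hH : HasConnectedPair H D) :
    HasCrossing cube H (Fin 3) D := by
  classical
  obtain ⟨A, B, hA, hB, hAB⟩ := hH
  let shift : W → Fin 3 := fun y => if y = y₁ then 2 else if par y then 1 else 0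
  have hR : ∀ v, IsFactoring H (fun d => (if isUnit v then A else B) d) := fun v => by
    split_ifs <;> assumption
  refine ⟨fun y i => cubeFlip (i + shift y), fun v => if isUnit v then A else B,
    fun y => (flipGraph_isFactoring cubeFlip_inj).reindex (Equiv.addRight (shift y)), hR, ?_⟩
  intro i d φ hK hL
  have hsh : shift y₁ = 2 := if_pos rfl
  have hshe : ∀ y, par y = false → y ≠ y₁ → shift y = 0 := fun y hp hy => by
    simp [shift, hy, hp]
  have hsho : ∀ y, par y = true → shift y = 1 := fun y hp => by
    have hy : y ≠ y₁ := fun e => by rw [e, hy₁] at hp; cases hp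
    simp [shift, hy, hp]
  have hL' : ∀ v y, φ (v, (if isUnit v then A d else B d) y) = φ (v, y) := fun v y => by
    have := hL (v, y)
    simp only at this
    split_ifs at this ⊢ <;> exact this
  have he : ∀ v y, par y = false → y ≠ y₁ → φ (cubeFlip i v, y) = φ (v, y) := fun v y hp hy => by
    have := hK (v, y)
    simpa [hshe y hp hy] using this
  have ho : ∀ v y, par y = true → φ (cubeFlip (i + 1) v, y) = φ (v, y) := fun v y hp => by
    have := hK (v, y)
    simpa [hsho y hp] using this
  have h1 : ∀ v, φ (cubeFlip (i + 2) v, y₁) = φ (v, y₁) := fun v => by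
    have := hK (v, y₁)
    simpa [hsh] using this
  have key := fun s => eq_of_cube_invariant (hA.invol d) (hA.ne d) (hB.invol d) (hB.ne d) (hAB d)
    par (fun y => hpar _ _ (hB.adj d y)) hodd y₁ hy₁ s
  rintro ⟨⟨p, q, r⟩, y⟩ ⟨⟨p', q', r'⟩, y'⟩
  fin_cases i
  · exact key (fun p q r y => φ ((p, q, r), y)) (fun p q r y => hL' (p, q, r) y)
      (fun p q r y => he (p, q, r) y) (fun p q r y => ho (p, q, r) y)
      (fun p q r => h1 (p, q, r)) p q r p' q' r' y y'
  · exact key (fun p q r y => φ ((r, p, q), y))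
      (fun p q r y => by
        rw [← hL' (r, p, q) y]
        congr 3
        cases p <;> cases q <;> cases r <;> rfl)
      (fun p q r y => he (r, p, q) y) (fun p q r y => ho (r, p, q) y)
      (fun p q r => h1 (r, p, q)) q r p q' r' p' y y'
  · exact key (fun p q r y => φ ((q, r, p), y))
      (fun p q r y => by
        rw [← hL' (q, r, p) y]
        congr 3
        cases p <;> cases q <;> cases r <;> rfl)
      (fun p q r y => he (q, r, p) y) (fun p q r y => ho (q, r, p) y)
      (fun p q r => h1 (q, r, p)) r p q r' p' q' y y'

/-- With two elements available, toggling both is a parity-preserving fixed-point-free involution,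
so the number of odd vertices is even. -/
theorem HypercubePair.three_hasCrossing {l : ℕ} (hl : 2 ≤ l) (h : HypercubePair l) :
    HasCrossing (hypercube 3) (hypercube l) (Fin 3) (Fin l) := by
  refine (HasConnectedPair.cube_hasCrossing hypercubeParity hypercubeParity_of_adj ?_ ∅
    (by simp [hypercubeParity]) h).map cubeIso (SimpleGraph.Iso.refl)
  have hij : (⟨0, by omega⟩ : Fin l) ≠ ⟨1, by omega⟩ := by simp
  refine ⟨fun s => symmDiff (symmDiff s {⟨0, by omega⟩}) {⟨1, by omega⟩}, fun s => ?_, fun s e => ?_,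
    fun s => ?_⟩
  · beta_reduce
    rw [symmDiff_right_comm s, symmDiff_symmDiff_cancel_right, symmDiff_symmDiff_cancel_right]
  · have h0 : (⟨0, by omega⟩ : Fin l) ∈ symmDiff (symmDiff s {⟨0, by omega⟩}) {⟨1, by omega⟩} ↔
      ⟨0, by omega⟩ ∈ s := by
      beta_reduce at e; rw [e]
    simp [Finset.mem_symmDiff] at h0
  · rw [hypercubeParity_of_adj _ _ ((hypercube_adj_iff _ _).2 ⟨_, rfl⟩),
      hypercubeParity_of_adj _ _ ((hypercube_adj_iff _ _).2 ⟨_, rfl⟩), Bool.not_not]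

/-- The crossing factorizations of hypercubes that the theorem asks for. -/
theorem hypercube_hasCrossing (k l : ℕ) (hk : 1 ≤ k) (hl : 1 ≤ l)
    (h : ¬ ((k = 3 ∧ l = 1) ∨ (k = 1 ∧ l = 3) ∨ (k = 3 ∧ l = 3))) :
    HasCrossing (hypercube k) (hypercube l) (Fin k) (Fin l) := by
  by_cases hk3 : k = 3
  · subst hk3
    exact (hypercubePair_of_ne_three l hl (by omega)).three_hasCrossing (by omega)
  by_cases hl3 : l = 3
  · subst hl3
    exact ((hypercubePair_of_ne_three k hk hk3).three_hasCrossing (by omega)).symm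
  exact (hypercubePair_of_ne_three k hk hk3).hasCrossing (hypercubePair_of_ne_three l hl hl3)

/-! ### Hamilton cycles from pairs of matchings -/

section Hamilton

variable {V ι : Type*} [DecidableEq V] {H : SimpleGraph V}

theorem IsHamiltonCycleSubgraph.constant {F : H.Subgraph} (hF : IsHamiltonCycleSubgraph F)
    {φ : V → Bool} (hφ : ∀ v w, F.Adj v w → φ v = φ w) (v w : V) : φ v = φ w := by
  obtain ⟨u, p, hp, rfl⟩ := hF
  have walk : ∀ {x y : V} (q : H.Walk x y), (∀ e ∈ q.edges, e ∈ p.edges) → φ x = φ y := by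
    intro x y q hq
    induction q with
    | nil => rfl
    | cons h q ih =>
      rw [← ih fun e he => hq e (by simp [he])]
      exact hφ _ _ (SimpleGraph.Walk.adj_toSubgraph_iff_mem_edges.2 (hq _ (by simp)))
  have key : ∀ v, φ u = φ v := fun v =>
    walk (p.takeUntil v (hp.mem_support v)) fun e he => p.edges_takeUntil_subset_edges _ he
  rw [← key v, key w]

/-- A component of a 2-regular finite graph is a cycle, and joint transitivity leaves only one
component. -/
theorem isHamiltonCycleSubgraph_of_jointlyTransitive [Finite V] [Nonempty V] {F : H.Subgraph}
    {s t : V → V} (hst : ∀ v, s v ≠ t v) (hF : ∀ v w, F.Adj v w ↔ s v = w ∨ t v = w)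
    (h : JointlyTransitive s t) : IsHamiltonCycleSubgraph F := by
  have hN : ∀ v, F.neighborSet v = {s v, t v} := fun v => by
    ext w
    simp only [SimpleGraph.Subgraph.mem_neighborSet, hF, Set.mem_insert_iff, Set.mem_singleton_iff,
      eq_comm]
  have hcyc : F.spanningCoe.IsCycles := fun v _ => by
    have : F.spanningCoe.neighborSet v = {s v, t v} := hN v
    rw [this, Set.ncard_pair (hst v)]
  obtain ⟨v⟩ := ‹Nonempty V›
  obtain ⟨p, hp, hverts⟩ := hcyc.exists_cycle_toSubgraph_verts_eq_connectedComponentSupp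
    (v := v) (c := F.spanningCoe.connectedComponentMk v) rfl ⟨s v, (hF _ _).2 (Or.inl rfl)⟩
  have hsupp : ∀ w, w ∈ p.support := by
    classical
    intro w
    have hadj : ∀ x y, F.Adj x y → (x ∈ p.support ↔ y ∈ p.support) := fun x y hxy => by
      rw [← p.mem_verts_toSubgraph, ← p.mem_verts_toSubgraph, hverts,
        SimpleGraph.ConnectedComponent.mem_supp_iff, SimpleGraph.ConnectedComponent.mem_supp_iff,
        SimpleGraph.ConnectedComponent.eq, SimpleGraph.ConnectedComponent.eq]
      have hxy' : F.spanningCoe.Adj x y := hxy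
      exact ⟨fun h => hxy'.symm.reachable.trans h, fun h => hxy'.reachable.trans h⟩
    have := h (fun x => decide (x ∈ p.support))
      (fun x => by simp only [hadj _ _ ((hF x (s x)).2 (Or.inl rfl))])
      (fun x => by simp only [hadj _ _ ((hF x (t x)).2 (Or.inr rfl))]) v w
    simpa using this
  have hle := F.spanningCoe_le
  refine ⟨v, p.mapLe hle, ?_, ?_⟩
  · rw [SimpleGraph.Walk.isHamiltonianCycle_iff_isCycle_and_support_count_tail_eq_one]
    have hc := hp.mapLe hle
    refine ⟨hc, fun a => List.count_eq_one_of_mem hc.support_nodup ?_⟩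
    have ha : a ∈ (p.mapLe hle).support := by simpa using hsupp a
    rw [← SimpleGraph.Walk.cons_tail_support] at ha
    rcases List.mem_cons.1 ha with rfl | ha
    · exact SimpleGraph.Walk.end_mem_tail_support hc.not_nil
    · exact ha
  · have hadj : ∀ x y, (p.mapLe hle).toSubgraph.Adj x y → F.Adj x y := fun x y hxy => by
      rw [SimpleGraph.Walk.adj_toSubgraph_iff_mem_edges] at hxy
      have : s(x, y) ∈ p.edges := by simpa using hxy
      exact p.adj_of_mem_edges this
    -- Both graphs have two neighbors at each vertex, so containment of the cycle in `F` is
    -- equality.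
    have hset : ∀ x, (p.mapLe hle).toSubgraph.neighborSet x = F.neighborSet x := fun x => by
      refine Set.eq_of_subset_of_ncard_le (fun y hy => hadj x y hy) ?_ (Set.toFinite _)
      rw [hN, Set.ncard_pair (hst x),
        (hp.mapLe hle).ncard_neighborSet_toSubgraph_eq_two (by simpa using hsupp x)]
    refine SimpleGraph.Subgraph.ext ?_ ?_
    · ext x
      refine ⟨fun _ => F.edge_vert ((hF x (s x)).2 (Or.inl rfl)), fun _ => ?_⟩
      rw [SimpleGraph.Walk.mem_verts_toSubgraph]
      simpa using hsupp x
    · ext x y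
      exact Set.ext_iff.1 (hset x) y

variable {M : ι → H.Subgraph} {f : ι → V → V}

theorem hamiltonPairGraph_adj_iff [Finite V] [Nonempty V] (hf : IsFactoring H f)
    (hM : ∀ i v w, (M i).Adj v w ↔ f i v = w) (i j : ι) :
    (hamiltonPairGraph M).Adj i j ↔ i ≠ j ∧ JointlyTransitive (f i) (f j) := by
  have hadj : ∀ v w, (M i ⊔ M j).Adj v w ↔ f i v = w ∨ f j v = w := fun v w => by
    rw [SimpleGraph.Subgraph.sup_adj, hM, hM]
  refine and_congr_right fun hij => ⟨fun h φ h1 h2 => ?_, fun h => ?_⟩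
  · refine h.constant fun v w hvw => ?_
    rcases (hadj v w).1 hvw with rfl | rfl
    · exact (h1 v).symm
    · exact (h2 v).symm
  · exact isHamiltonCycleSubgraph_of_jointlyTransitive (fun v e => hij (hf.inj _ _ v e)) hadj h

omit [DecidableEq V] in
theorem IsFactoring.isOneFactorization (hf : IsFactoring H f)
    (hM : ∀ i v w, (M i).Adj v w ↔ f i v = w) : IsOneFactorization M := by
  refine ⟨fun i => ?_, fun e he => ?_⟩
  · rw [SimpleGraph.Subgraph.isPerfectMatching_iff]
    exact fun v => ⟨f i v, (hM _ _ _).2 rfl, fun w hw => ((hM _ _ _).1 hw).symm⟩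
  · induction e with
    | _ v w =>
      obtain ⟨i, hi⟩ := (hf.adj_iff v w).1 he
      refine ⟨i, (hM _ _ _).2 hi, fun j hj => hf.inj _ _ v ?_⟩
      rw [hi]
      exact (hM _ _ _).1 hj

omit [DecidableEq V] in
theorem IsOneFactorization.exists_isFactoring (h : IsOneFactorization M) :
    ∃ f : ι → V → V, IsFactoring H f ∧ ∀ i v w, (M i).Adj v w ↔ f i v = w := by
  have hex : ∀ i v, ∃! w, (M i).Adj v w := fun i =>
    SimpleGraph.Subgraph.isPerfectMatching_iff.1 (h.1 i)
  choose f hf using fun i v => (hex i v).exists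
  have hM : ∀ i v w, (M i).Adj v w ↔ f i v = w := fun i v w =>
    ⟨fun hw => (hex i v).unique (hf i v) hw, fun hw => hw ▸ hf i v⟩
  refine ⟨f, ⟨fun i v => (hM _ _ _).1 (hf i v).symm, fun v w => ⟨fun hvw => ?_, ?_⟩,
    fun i j v e => ?_⟩, hM⟩
  · obtain ⟨i, hi, -⟩ := h.2 s(v, w) hvw
    exact ⟨i, (hM _ _ _).1 hi⟩
  · rintro ⟨i, hi⟩
    exact ((hM i v w).2 hi).adj_sub
  · have h1 : (M i).Adj v (f i v) := hf i v
    exact (h.2 s(v, f i v) h1.adj_sub).unique h1 ((hM _ _ _).2 e.symm)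

end Hamilton

/-! ### Splitting a factorization into layers -/

/-- A factorization of a box product whose factors are parallel to the sides splits into
factorizations of the layers. -/
theorem IsFactoring.exists_layers {V W C D : Type*} {G : SimpleGraph V} {H : SimpleGraph W}
    {f : C ⊕ D → V × W → V × W} (hf : IsFactoring (SimpleGraph.boxProd G H) f)
    (hC : ∀ c v, (f (.inl c) v).2 = v.2) (hD : ∀ d v, (f (.inr d) v).1 = v.1) :
    ∃ (P : W → C → V → V) (U : V → D → W → W), (∀ y, IsFactoring G (P y)) ∧
      (∀ x, IsFactoring H (U x)) ∧ (∀ c v, f (.inl c) v = (P v.2 c v.1, v.2)) ∧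
      ∀ d v, f (.inr d) v = (v.1, U v.1 d v.2) := by
  have h1 : ∀ c v, f (.inl c) v = ((f (.inl c) (v.1, v.2)).1, v.2) := fun c v =>
    Prod.ext rfl (hC c v)
  have h2 : ∀ d v, f (.inr d) v = (v.1, (f (.inr d) (v.1, v.2)).2) := fun d v =>
    Prod.ext (hD d v) rfl
  refine ⟨fun y c x => (f (.inl c) (x, y)).1, fun x d y => (f (.inr d) (x, y)).2, fun y => ?_,
    fun x => ?_, h1, h2⟩
  · refine ⟨fun c x => ?_, fun x x' => ?_, fun c c' x e => ?_⟩
    · have := hf.invol (.inl c) (x, y)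
      rw [h1 c (x, y)] at this
      exact congrArg Prod.fst this
    · rw [← SimpleGraph.boxProd_adj_left (H := H) (b := y), hf.adj_iff]
      constructor
      · rintro ⟨c | d, h⟩
        · exact ⟨c, congrArg Prod.fst h⟩
        · refine absurd ?_ (hf.ne (.inr d) (x, y))
          have h3 := hD d (x, y)
          rw [h] at h3 ⊢
          simp only at h3
          rw [h3]
      · rintro ⟨c, h⟩
        exact ⟨.inl c, (h1 c (x, y)).trans (Prod.ext h rfl)⟩
    · have := hf.inj (.inl c) (.inl c') (x, y) (by rw [h1 c, h1 c']; exact Prod.ext e rfl)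
      exact Sum.inl_injective this
  · refine ⟨fun d y => ?_, fun y y' => ?_, fun d d' y e => ?_⟩
    · have := hf.invol (.inr d) (x, y)
      rw [h2 d (x, y)] at this
      exact congrArg Prod.snd this
    · rw [← SimpleGraph.boxProd_adj_right (G := G) (a := x), hf.adj_iff]
      constructor
      · rintro ⟨c | d, h⟩
        · refine absurd ?_ (hf.ne (.inl c) (x, y))
          have h3 := hC c (x, y)
          rw [h] at h3 ⊢
          simp only at h3
          rw [h3]
        · exact ⟨d, congrArg Prod.snd h⟩
      · rintro ⟨d, h⟩
        exact ⟨.inr d, (h2 d (x, y)).trans (Prod.ext rfl h)⟩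
    · have := hf.inj (.inr d) (.inr d') (x, y) (by rw [h2 d, h2 d']; exact Prod.ext rfl e)
      exact Sum.inr_injective this

/-- Isomorphic graphs have equally many edges. This upgrades an abstract isomorphism with `K_{k,l}`
to equality with the graph of the two sides. -/
theorem SimpleGraph.eq_of_le_of_iso {V : Type*} [Finite V] {G K : SimpleGraph V} (hle : G ≤ K)
    (e : G ≃g K) : G = K := by
  classical
  have := Fintype.ofFinite V
  rw [← SimpleGraph.edgeFinset_inj]
  exact Finset.eq_of_subset_of_card_le (SimpleGraph.edgeFinset_mono hle)
    e.card_edgeFinset_eq.ge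

/-! ### Direction respecting factorizations -/

section Directions

variable {k l : ℕ} {M : Fin (k + l) → (hypercube (k + l)).Subgraph}
  {f : Fin (k + l) → Finset (Fin (k + l)) → Finset (Fin (k + l))}

/-- The first `k` factors do not change the last `l` elements, and conversely. -/
structure KeepsSides (f : Fin (k + l) → Finset (Fin (k + l)) → Finset (Fin (k + l))) : Prop where
  left : ∀ (i : Fin k) (j : Fin l) v, Fin.natAdd k j ∈ f (Fin.castAdd l i) v ↔ Fin.natAdd k j ∈ v
  right : ∀ (i : Fin k) (j : Fin l) v, Fin.castAdd l i ∈ f (Fin.natAdd k j) v ↔ Fin.castAdd l i ∈ v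

theorem castAdd_ne_natAdd (i : Fin k) (j : Fin l) : Fin.castAdd l i ≠ Fin.natAdd k j := by
  intro e
  have := congrArg Fin.val e
  simp at this
  omega

theorem isDirectionRespecting_iff (hM : ∀ i v w, (M i).Adj v w ↔ f i v = w) :
    IsDirectionRespecting M ↔ KeepsSides f := by
  constructor
  · rintro ⟨h1, h2⟩
    refine ⟨fun i j v => ?_, fun i j v => ?_⟩
    · by_contra hc
      obtain ⟨i', hi'⟩ := h1 i v _ ((hM _ _ _).2 rfl) (Fin.natAdd k j) (by
        rw [Finset.mem_symmDiff]; tauto)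
      exact castAdd_ne_natAdd _ _ hi'
    · by_contra hc
      obtain ⟨j', hj'⟩ := h2 j v _ ((hM _ _ _).2 rfl) (Fin.castAdd l i) (by
        rw [Finset.mem_symmDiff]; tauto)
      exact castAdd_ne_natAdd _ _ hj'.symm
  · rintro ⟨h1, h2⟩
    refine ⟨fun i v w hvw m hm => ?_, fun j v w hvw m hm => ?_⟩
    · rw [hM] at hvw
      subst hvw
      rw [Finset.mem_symmDiff] at hm
      revert hm
      refine Fin.addCases (fun i' _ => ⟨i', rfl⟩) (fun j' hm => ?_) m
      rw [h1] at hm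
      tauto
    · rw [hM] at hvw
      subst hvw
      rw [Finset.mem_symmDiff] at hm
      revert hm
      refine Fin.addCases (fun i' hm => ?_) (fun j' _ => ⟨j', rfl⟩) m
      rw [h2] at hm
      tauto

/-- Membership of an element of the other side is a nonconstant invariant of both factors. -/
theorem KeepsSides.not_trans_left (h : KeepsSides f) (hl : 1 ≤ l) (i i' : Fin k) :
    ¬ JointlyTransitive (f (Fin.castAdd l i)) (f (Fin.castAdd l i')) := fun hT => by
  have := hT (fun v => decide (Fin.natAdd k (⟨0, hl⟩ : Fin l) ∈ v)) (fun v => by simp only [h.left])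
    (fun v => by simp only [h.left]) ∅ {Fin.natAdd k ⟨0, hl⟩}
  simp at this

theorem KeepsSides.not_trans_right (h : KeepsSides f) (hk : 1 ≤ k) (j j' : Fin l) :
    ¬ JointlyTransitive (f (Fin.natAdd k j)) (f (Fin.natAdd k j')) := fun hT => by
  have := hT (fun v => decide (Fin.castAdd l (⟨0, hk⟩ : Fin k) ∈ v)) (fun v => by simp only [h.right])
    (fun v => by simp only [h.right]) ∅ {Fin.castAdd l ⟨0, hk⟩}
  simp at this

/-- The complete bipartite graph on the factors with parts of sizes `k` and `l`. -/
def sidesGraph (k l : ℕ) : SimpleGraph (Fin (k + l)) :=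
  (completeBipartiteGraph (Fin k) (Fin l)).comap finSumFinEquiv.symm

/-- It is a complete bipartite graph. -/
def sidesGraphIso (k l : ℕ) : sidesGraph k l ≃g completeBipartiteGraph (Fin k) (Fin l) :=
  SimpleGraph.Iso.comap finSumFinEquiv.symm _

theorem sidesGraph_adj_iff (i i' : Fin k) (j j' : Fin l) :
    ¬ (sidesGraph k l).Adj (Fin.castAdd l i) (Fin.castAdd l i') ∧
      ¬ (sidesGraph k l).Adj (Fin.natAdd k j) (Fin.natAdd k j') ∧
      (sidesGraph k l).Adj (Fin.castAdd l i) (Fin.natAdd k j) := by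
  simp [sidesGraph]

theorem KeepsSides.hamiltonPairGraph_le (h : KeepsSides f) (hk : 1 ≤ k) (hl : 1 ≤ l)
    (hf : IsFactoring (hypercube (k + l)) f) (hM : ∀ i v w, (M i).Adj v w ↔ f i v = w) :
    hamiltonPairGraph M ≤ sidesGraph k l := by
  intro m m' hmm
  have hT := ((hamiltonPairGraph_adj_iff hf hM m m').1 hmm).2
  revert hT
  refine Fin.addCases (fun i => ?_) (fun j => ?_) m <;>
    refine Fin.addCases (fun i' => ?_) (fun j' => ?_) m' <;> intro hT
  · exact absurd hT (h.not_trans_left hl i i')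
  · exact (sidesGraph_adj_iff i i j' j').2.2
  · exact (sidesGraph_adj_iff i' i' j j).2.2.symm
  · exact absurd hT (h.not_trans_right hk j j')

theorem exists_directionRespecting_of_hasCrossing (hk : 1 ≤ k) (hl : 1 ≤ l)
    (h : HasCrossing (hypercube k) (hypercube l) (Fin k) (Fin l)) :
    ∃ M : Fin (k + l) → (hypercube (k + l)).Subgraph, IsOneFactorization M ∧
      IsDirectionRespecting M ∧
      Nonempty (hamiltonPairGraph M ≃g completeBipartiteGraph (Fin k) (Fin l)) := by
  obtain ⟨P, U, hPU⟩ := h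
  have hf := ((IsFactoring.layered hPU.left hPU.right).map (hypercubeSumIso k l)).reindex
    finSumFinEquiv.symm
  set f := fun d : Fin (k + l) => (fun c w => hypercubeSumIso k l ((Sum.elim
    (fun c v => (P v.2 c v.1, v.2)) (fun d v => (v.1, U v.1 d v.2)) :
      Fin k ⊕ Fin l → Finset (Fin k) × Finset (Fin l) → Finset (Fin k) × Finset (Fin l)) c
      ((hypercubeSumIso k l).symm w))) (finSumFinEquiv.symm d) with hfdef
  have hmem1 : ∀ (v : Finset (Fin k) × Finset (Fin l)) (i : Fin k),
      Fin.castAdd l i ∈ hypercubeSumIso k l v ↔ i ∈ v.1 := castAdd_mem_finsetFinSumEquiv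
  have hmem2 : ∀ (v : Finset (Fin k) × Finset (Fin l)) (j : Fin l),
      Fin.natAdd k j ∈ hypercubeSumIso k l v ↔ j ∈ v.2 := natAdd_mem_finsetFinSumEquiv
  have hkeep : KeepsSides f := by
    refine ⟨fun i j v => ?_, fun i j v => ?_⟩
    · obtain ⟨v, rfl⟩ := (hypercubeSumIso k l).surjective v
      simp [hfdef, hmem2]
    · obtain ⟨v, rfl⟩ := (hypercubeSumIso k l).surjective v
      simp [hfdef, hmem1]
  let M : Fin (k + l) → (hypercube (k + l)).Subgraph := fun i =>
    { verts := Set.univ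
      Adj := fun v w => f i v = w
      adj_sub := fun {v w} hvw => (hf.adj_iff v w).2 ⟨i, hvw⟩
      edge_vert := fun _ => Set.mem_univ _
      symm := ⟨fun v w hvw => by rw [← hvw, hf.invol]⟩ }
  have hM : ∀ i v w, (M i).Adj v w ↔ f i v = w := fun _ _ _ => Iff.rfl
  refine ⟨M, hf.isOneFactorization hM, (isDirectionRespecting_iff hM).2 hkeep, ?_⟩
  have hcross : ∀ (i : Fin k) (j : Fin l),
      JointlyTransitive (f (Fin.castAdd l i)) (f (Fin.natAdd k j)) := fun i j =>
    (hPU.trans i j).conj (hypercubeSumIso k l).toEquiv (fun v => by simp [hfdef])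
      (fun v => by simp [hfdef])
  have hadj : ∀ (i : Fin k) (j : Fin l),
      (hamiltonPairGraph M).Adj (Fin.castAdd l i) (Fin.natAdd k j) := fun i j =>
    (hamiltonPairGraph_adj_iff hf hM _ _).2 ⟨castAdd_ne_natAdd i j, hcross i j⟩
  have heq : hamiltonPairGraph M = sidesGraph k l := by
    refine le_antisymm (hkeep.hamiltonPairGraph_le hk hl hf hM) fun m m' => ?_
    refine Fin.addCases (fun i => ?_) (fun j => ?_) m <;>
      refine Fin.addCases (fun i' => ?_) (fun j' => ?_) m' <;> intro hmm
    · exact absurd hmm (sidesGraph_adj_iff i i' ⟨0, hl⟩ ⟨0, hl⟩).1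
    · exact hadj i j'
    · exact (hadj i' j).symm
    · exact absurd hmm (sidesGraph_adj_iff ⟨0, hk⟩ ⟨0, hk⟩ j j').2.1
  rw [heq]
  exact ⟨sidesGraphIso k l⟩

theorem hasCrossing_of_directionRespecting (hk : 1 ≤ k) (hl : 1 ≤ l)
    (h1 : IsOneFactorization M) (h2 : IsDirectionRespecting M)
    (e : hamiltonPairGraph M ≃g completeBipartiteGraph (Fin k) (Fin l)) :
    HasCrossing (hypercube k) (hypercube l) (Fin k) (Fin l) := by
  obtain ⟨f, hf, hM⟩ := h1.exists_isFactoring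
  have hkeep := (isDirectionRespecting_iff hM).1 h2
  have heq := SimpleGraph.eq_of_le_of_iso (hkeep.hamiltonPairGraph_le hk hl hf hM)
    (e.trans (sidesGraphIso k l).symm)
  have hcross : ∀ (i : Fin k) (j : Fin l),
      JointlyTransitive (f (Fin.castAdd l i)) (f (Fin.natAdd k j)) := fun i j =>
    ((hamiltonPairGraph_adj_iff hf hM _ _).1 (heq ▸ (sidesGraph_adj_iff i i j j).2.2)).2
  have hmem1 : ∀ (v : Finset (Fin k) × Finset (Fin l)) (i : Fin k),
      Fin.castAdd l i ∈ hypercubeSumIso k l v ↔ i ∈ v.1 := castAdd_mem_finsetFinSumEquiv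
  have hmem2 : ∀ (v : Finset (Fin k) × Finset (Fin l)) (j : Fin l),
      Fin.natAdd k j ∈ hypercubeSumIso k l v ↔ j ∈ v.2 := natAdd_mem_finsetFinSumEquiv
  have hg := (hf.reindex finSumFinEquiv).map (hypercubeSumIso k l).symm
  obtain ⟨P, U, hP, hU, hPf, hUf⟩ := hg.exists_layers
    (fun i v => by
      ext j
      rw [← hmem2, RelIso.apply_symm_apply, finSumFinEquiv_apply_left, hkeep.left]
      exact hmem2 v j)
    (fun j v => by
      ext i
      rw [← hmem1, RelIso.apply_symm_apply, finSumFinEquiv_apply_right, hkeep.right]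
      exact hmem1 v i)
  refine ⟨P, U, hP, hU, fun i j => ?_⟩
  refine (hcross i j).conj (hypercubeSumIso k l).symm.toEquiv (fun v => ?_) fun v => ?_
  · exact (hPf i _).symm.trans (by simp)
  · exact (hUf j _).symm.trans (by simp)

end Directions

/-! ### The sign obstruction in dimension three -/

/-- `f` is an involution that exchanges the two classes of `par`. -/
structure SwapsParity {V : Type*} (par : V → Bool) (f : V → V) : Prop where
  invol : ∀ v, f (f v) = v
  flip : ∀ v, par (f v) = !par v

theorem IsFactoring.swapsParity {V C : Type*} {G : SimpleGraph V} {f : C → V → V}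
    (hf : IsFactoring G f) {par : V → Bool} (hpar : ∀ v w, G.Adj v w → par w = !par v) (c : C) :
    SwapsParity par (f c) := ⟨hf.invol c, fun v => hpar _ _ (hf.adj c v)⟩

section Sign

variable {V : Type*} {par : V → Bool} {f g h : V → V}

/-- The composition of two matchings of a bipartite graph, as a permutation of one class. -/
def relPerm (hf : SwapsParity par f) (hg : SwapsParity par g) :
    Equiv.Perm {v // par v = false} where
  toFun v := ⟨g (f v), by rw [hg.flip, hf.flip, v.2]; rfl⟩
  invFun v := ⟨f (g v), by rw [hf.flip, hg.flip, v.2]; rfl⟩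
  left_inv v := Subtype.ext (by simp only [hg.invol, hf.invol])
  right_inv v := Subtype.ext (by simp only [hg.invol, hf.invol])

variable [Fintype V] [DecidableEq V]

/-- Relative signs compose, so each factor can be given a sign with respect to a fixed reference
matching. -/
theorem sign_relPerm_trans (hf : SwapsParity par f) (hg : SwapsParity par g)
    (hh : SwapsParity par h) : (relPerm hf hh).sign = (relPerm hf hg).sign * (relPerm hg hh).sign := by
  rw [mul_comm, ← Equiv.Perm.sign_mul]
  congr 1
  ext v
  simp [relPerm, hg.invol]

theorem sign_relPerm_symm (hf : SwapsParity par f) (hg : SwapsParity par g) :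
    (relPerm hf hg).sign = (relPerm hg hf).sign := by
  rw [← Equiv.Perm.sign_inv]
  rfl

/-- Two matchings whose union is a single cycle have opposite signs. -/
theorem sign_relPerm_of_jointlyTransitive (hf : SwapsParity par f) (hg : SwapsParity par g)
    (heven : Even (Fintype.card {v // par v = false})) [Nonempty {v // par v = false}]
    (hT : JointlyTransitive f g) : (relPerm hf hg).sign = -1 := by
  classical
  set σ := relPerm hf hg with hσ
  have hf_odd : ∀ v, par v ≠ false → par (f v) = false := fun v hv => by
    rw [hf.flip, Bool.eq_true_of_not_eq_false hv]; rfl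
  have hg_odd : ∀ v, par v ≠ false → par (g v) = false := fun v hv => by
    rw [hg.flip, Bool.eq_true_of_not_eq_false hv]; rfl
  have hf_even : ∀ v, par v = false → par (f v) ≠ false := fun v hv => by
    rw [hf.flip, hv]; simp
  have hg_even : ∀ v, par v = false → par (g v) ≠ false := fun v hv => by
    rw [hg.flip, hv]; simp
  have hsame : ∀ x y, σ.SameCycle x y := by
    intro x y
    -- The cycle of `σ` through `x` is extended to the odd vertices along `f`, which gives a
    -- function invariant under both matchings.
    let φ : V → Bool := fun v => if hv : par v = false then decide (σ.SameCycle x ⟨v, hv⟩) else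
      decide (σ.SameCycle x ⟨f v, hf_odd v hv⟩)
    have h1 : ∀ v, φ (f v) = φ v := fun v => by
      by_cases hv : par v = false
      · simp only [φ, dif_pos hv, dif_neg (hf_even v hv), hf.invol]
      · simp only [φ, dif_neg hv, dif_pos (hf_odd v hv)]
    have h2 : ∀ v, φ (g v) = φ v := fun v => by
      by_cases hv : par v = false
      · simp only [φ, dif_pos hv, dif_neg (hg_even v hv)]
        have : σ ⟨f (g v), hf_odd _ (hg_even v hv)⟩ = ⟨v, hv⟩ :=
          Subtype.ext (by simp [hσ, relPerm, hf.invol, hg.invol])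
        exact decide_eq_decide.2 (by rw [← this, Equiv.Perm.sameCycle_apply_right])
      · simp only [φ, dif_neg hv, dif_pos (hg_odd v hv)]
        have : σ ⟨f v, hf_odd v hv⟩ = ⟨g v, hg_odd v hv⟩ :=
          Subtype.ext (by simp [hσ, relPerm, hf.invol])
        exact decide_eq_decide.2 (by rw [← this, Equiv.Perm.sameCycle_apply_right])
    have := hT φ h1 h2 x y
    simp only [φ, dif_pos x.2, dif_pos y.2] at this
    have hxx : σ.SameCycle x ⟨x.1, x.2⟩ := Equiv.Perm.SameCycle.refl _ _
    rw [decide_eq_true hxx] at this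
    exact of_decide_eq_true this.symm
  have hnontriv : Nontrivial {v // par v = false} := by
    rw [← Fintype.one_lt_card_iff_nontrivial]
    have h0 : 0 < Fintype.card {v // par v = false} := Fintype.card_pos
    obtain ⟨n, hn⟩ := heven
    omega
  have hmove : ∀ x, σ x ≠ x := fun x hx => by
    obtain ⟨y, hy⟩ := exists_ne x
    exact hy ((hsame x y).eq_of_left hx).symm
  obtain ⟨x⟩ := ‹Nonempty {v // par v = false}›
  have hcyc : σ.IsCycle := ⟨x, hmove x, fun y _ => hsame x y⟩
  have hsupp : σ.support = Finset.univ := by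
    ext y; simp [hmove y]
  rw [hcyc.sign, hsupp, Finset.card_univ, heven.neg_one_pow]

theorem sign_relPerm_conj {V' : Type*} [Fintype V'] [DecidableEq V'] {par' : V' → Bool}
    {f' g' : V' → V'} (hf : SwapsParity par f) (hg : SwapsParity par g)
    (hf' : SwapsParity par' f') (hg' : SwapsParity par' g') (e : V ≃ V')
    (hp : ∀ v, par' (e v) = par v) (h1 : ∀ v, f' (e v) = e (f v)) (h2 : ∀ v, g' (e v) = e (g v)) :
    (relPerm hf' hg').sign = (relPerm hf hg).sign := by
  symm
  refine Equiv.Perm.sign_eq_sign_of_equiv _ _ (e.subtypeEquiv fun v => by rw [hp]) fun v => ?_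
  exact Subtype.ext (by simp [relPerm, h1, h2])

end Sign

/-- The parity of a vertex of the three-dimensional cube. -/
def cubeParity (v : Bool × Bool × Bool) : Bool := xor v.1 (xor v.2.1 v.2.2)

theorem cubeParity_of_adj (v w : Bool × Bool × Bool) (h : cube.Adj v w) :
    cubeParity w = !cubeParity v := by
  obtain ⟨i, rfl⟩ := h
  revert i v
  decide

theorem cube_eq_of_snd_eq {v w : Bool × Bool × Bool} (h : v.2 = w.2)
    (hp : cubeParity v = cubeParity w) : v = w := by
  revert v w
  decide

theorem cube_adj_snd {v w : Bool × Bool × Bool} (h : cube.Adj v w) : w.2 ≠ (!v.2.1, !v.2.2) := by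
  obtain ⟨i, rfl⟩ := h
  revert i v
  decide

set_option synthInstance.maxSize 1000 in
/-- Three disjoint permutations of four points that also avoid a fixed fixed-point-free involution
have signs with product one. -/
theorem sign_mul_sign_mul_sign : ∀ a : Equiv.Perm (Bool × Bool), (∀ u, a u ≠ (!u.1, !u.2)) →
    ∀ b : Equiv.Perm (Bool × Bool), (∀ u, b u ≠ (!u.1, !u.2) ∧ b u ≠ a u) →
    ∀ c : Equiv.Perm (Bool × Bool), (∀ u, c u ≠ (!u.1, !u.2) ∧ c u ≠ a u ∧ c u ≠ b u) →
    a.sign * b.sign * c.sign = 1 := by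
  -- With the fixed involution, which is even, the three permutations form the rows of a Latin
  -- square of order 4; the row signs of such a square always multiply to 1. Each condition precedes
  -- the next quantifier, which prunes the search.
  decide +kernel

/-! ### Signs in a product with the three-dimensional cube -/

section CubeProduct

variable {W : Type*} [Fintype W] [DecidableEq W] (parW : W → Bool)

/-- The parity of a vertex of a product of the cube with another graph. -/
def cubeProdParity (v : (Bool × Bool × Bool) × W) : Bool := xor (cubeParity v.1) (parW v.2)

/-- The even vertex of the cube product with given coordinates except the first. -/
def evenLift (u : (Bool × Bool) × W) : Bool × Bool × Bool :=
  (xor (xor u.1.1 u.1.2) (parW u.2), u.1)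

omit [Fintype W] [DecidableEq W] in
theorem cubeParity_evenLift (u : (Bool × Bool) × W) :
    cubeParity (evenLift parW u) = parW u.2 := by
  obtain ⟨⟨p, q⟩, y⟩ := u
  simp only [cubeParity, evenLift]
  cases p <;> cases q <;> cases parW y <;> rfl

/-- The even vertices of a product with the cube, by their coordinates except the first. -/
def evenEquiv : {v : (Bool × Bool × Bool) × W // cubeProdParity parW v = false} ≃
    (Bool × Bool) × W where
  toFun v := (v.1.1.2, v.1.2)
  invFun u := ⟨(evenLift parW u, u.2), by
    rw [cubeProdParity, cubeParity_evenLift, Bool.xor_self]⟩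
  left_inv v := by
    obtain ⟨⟨x, y⟩, hv⟩ := v
    refine Subtype.ext (Prod.ext (cube_eq_of_snd_eq rfl ?_) rfl)
    rw [cubeParity_evenLift]
    revert hv
    simp only [cubeProdParity]
    cases cubeParity x <;> cases parW y <;> simp
  right_inv u := rfl

/-- Toggling the first coordinate. -/
def firstFlip (v : (Bool × Bool × Bool) × W) : (Bool × Bool × Bool) × W := (cubeFlip 0 v.1, v.2)

omit [Fintype W] [DecidableEq W] in
theorem firstFlip_swapsParity : SwapsParity (cubeProdParity parW) firstFlip where
  invol v := Prod.ext (cubeFlip_flip 0 v.1) rfl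
  flip v := by
    rw [cubeProdParity, cubeProdParity, firstFlip,
      cubeParity_of_adj v.1 _ ⟨0, rfl⟩, Bool.not_xor]

variable {parW}

omit [Fintype W] [DecidableEq W] in
theorem layer_swapsParity {P : W → Fin 3 → Bool × Bool × Bool → Bool × Bool × Bool}
    (hP : ∀ y, IsFactoring cube (P y)) (i : Fin 3) :
    SwapsParity (cubeProdParity parW) (fun v => (P v.2 i v.1, v.2)) where
  invol v := Prod.ext ((hP _).invol _ _) rfl
  flip v := by
    rw [cubeProdParity, cubeProdParity, cubeParity_of_adj v.1 _ ((hP v.2).adj i v.1), Bool.not_xor]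

omit [Fintype W] [DecidableEq W] in
theorem column_swapsParity {u : Bool × Bool × Bool → W → W}
    (hu : ∀ x, SwapsParity parW (u x)) :
    SwapsParity (cubeProdParity parW) (fun v => (v.1, u v.1 v.2)) where
  invol v := Prod.ext rfl ((hu _).invol _)
  flip v := by
    rw [cubeProdParity, cubeProdParity, (hu v.1).flip, Bool.xor_not]

/-- A factorization of the layers parallel to the cube has sign product one relative to the
first direction. -/
theorem prod_sign_layers {P : W → Fin 3 → Bool × Bool × Bool → Bool × Bool × Bool}
    (hP : ∀ y, IsFactoring cube (P y)) :
    ∏ i, (relPerm (layer_swapsParity (parW := parW) hP i) (firstFlip_swapsParity parW)).sign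
      = 1 := by
  have hpar : ∀ y i u, cubeParity (P y i (evenLift parW (u, y))) = !parW y := fun y i u => by
    rw [cubeParity_of_adj _ _ ((hP y).adj i _), cubeParity_evenLift]
  have hinj : ∀ y i, Function.Injective fun u : Bool × Bool => (P y i (evenLift parW (u, y))).2 :=
    fun y i u u' e => by
      have h1 := cube_eq_of_snd_eq e (by rw [hpar, hpar])
      have h2 := congrArg (P y i) h1
      rw [(hP y).invol, (hP y).invol] at h2
      exact congrArg Prod.snd h2
  -- Returning from the odd neighbor by toggling the first bit keeps the last two bits, so in layer
  -- `y` the relative permutation acts on these alone.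
  let τ : Fin 3 → W → Equiv.Perm (Bool × Bool) := fun i y =>
    Equiv.ofBijective _ (Finite.injective_iff_bijective.1 (hinj y i))
  have hτ : ∀ i y u, τ i y u = (P y i (evenLift parW (u, y))).2 := fun _ _ _ => rfl
  have hsign : ∀ i, (relPerm (layer_swapsParity (parW := parW) hP i)
      (firstFlip_swapsParity parW)).sign = ∏ y, (τ i y).sign := fun i => by
    rw [← Equiv.Perm.sign_prodCongrLeft]
    refine Equiv.Perm.sign_eq_sign_of_equiv _ _ (evenEquiv parW) fun v => ?_
    obtain ⟨u, rfl⟩ := (evenEquiv parW).symm.surjective v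
    rw [Equiv.apply_symm_apply]
    rfl
  have hdisj : ∀ i j y u, i ≠ j → τ i y u ≠ τ j y u := fun i j y u hij e =>
    hij ((hP y).inj _ _ _ (cube_eq_of_snd_eq e (by rw [hpar, hpar])))
  have havoid : ∀ i y u, τ i y u ≠ (!u.1, !u.2) := fun i y u =>
    cube_adj_snd ((hP y).adj i (evenLift parW (u, y)))
  simp only [hsign]
  rw [Finset.prod_comm]
  refine Finset.prod_eq_one fun y _ => ?_
  rw [Fin.prod_univ_three]
  exact sign_mul_sign_mul_sign _ (havoid 0 y) _
    (fun u => ⟨havoid 1 y u, hdisj 1 0 y u (by decide)⟩) _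
    fun u => ⟨havoid 2 y u, hdisj 2 0 y u (by decide), hdisj 2 1 y u (by decide)⟩

/-- Two reference directions on different sides have the same sign. -/
theorem sign_firstFlip {g : W → W} (hg : SwapsParity parW g) :
    (relPerm (firstFlip_swapsParity parW) (column_swapsParity fun _ => hg)).sign = 1 := by
  let τ : Equiv.Perm W := ⟨g, g, hg.invol, hg.invol⟩
  have : (relPerm (firstFlip_swapsParity parW) (column_swapsParity fun _ => hg)).sign =
      Equiv.Perm.sign (Equiv.prodCongrRight fun _ : Bool × Bool => τ) := by
    refine Equiv.Perm.sign_eq_sign_of_equiv _ _ (evenEquiv parW) fun v => ?_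
    obtain ⟨u, rfl⟩ := (evenEquiv parW).symm.surjective v
    rw [Equiv.apply_symm_apply]
    rfl
  -- The permutation consists of four copies of `τ`, one for each value of the last two bits, so its
  -- sign is a fourth power.
  rw [this, Equiv.Perm.sign_prodCongrRight, Finset.prod_const]
  exact (show Even (Finset.univ : Finset (Bool × Bool)).card from ⟨2, rfl⟩).elim
    fun n hn => by rw [hn, pow_add, Int.units_mul_self]

/-- The sign obstruction: there is no crossing factorization with the cube when the number of
factors on the other side is odd and their signs multiply to one. -/
theorem not_hasCrossing_cube {D : Type*} [Fintype D] [Nonempty W] {H : SimpleGraph W}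
    (hpar : ∀ v w, H.Adj v w → parW w = !parW v) (hD : Odd (Fintype.card D)) {g : W → W}
    (hg : SwapsParity parW g)
    (hprod : ∀ (U : Bool × Bool × Bool → D → W → W) (hU : ∀ x, IsFactoring H (U x)),
      ∏ d, (relPerm (column_swapsParity fun x => (hU x).swapsParity hpar d)
        (column_swapsParity fun _ => hg)).sign = 1) :
    ¬ HasCrossing cube H (Fin 3) D := by
  rintro ⟨P, U, hP, hU, hT⟩
  have hev : Even (Fintype.card {v // cubeProdParity parW v = false}) := by
    rw [Fintype.card_congr (evenEquiv parW), Fintype.card_prod]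
    exact (show Even (Fintype.card (Bool × Bool)) from ⟨2, rfl⟩).mul_right _
  have hne : Nonempty {v // cubeProdParity parW v = false} := (evenEquiv parW).nonempty
  set a : Fin 3 → ℤˣ := fun i =>
    (relPerm (layer_swapsParity (parW := parW) hP i) (firstFlip_swapsParity parW)).sign with ha
  set b : D → ℤˣ := fun d => (relPerm (column_swapsParity fun x => (hU x).swapsParity hpar d)
    (column_swapsParity fun _ => hg)).sign with hb
  have hG := column_swapsParity (parW := parW) (u := fun _ => g) fun _ => hg
  have hab : ∀ i d, a i * b d = -1 := fun i d => by
    rw [← sign_relPerm_of_jointlyTransitive (layer_swapsParity (parW := parW) hP i)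
      (column_swapsParity fun x => (hU x).swapsParity hpar d) hev (hT i d),
      sign_relPerm_trans _ (firstFlip_swapsParity parW) _,
      sign_relPerm_trans (firstFlip_swapsParity parW) hG _,
      sign_firstFlip hg, one_mul, sign_relPerm_symm hG]
  have ha1 : a 0 * a 1 * a 2 = 1 := by
    rw [← Fin.prod_univ_three]
    exact prod_sign_layers hP
  -- A right factor of sign `1` would force all three left signs to be `-1`, whose product is not
  -- `1`.
  have hb1 : ∀ d, b d = -1 := fun d => by
    have h0 := hab 0 d
    have h1 := hab 1 d
    have h2 := hab 2 d
    rcases Int.units_eq_one_or (b d) with e | e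
    · rw [e, mul_one] at h0 h1 h2
      rw [h0, h1, h2] at ha1
      exact absurd ha1 (by decide)
    · exact e
  have := hprod U hU
  change ∏ d, b d = 1 at this
  simp only [hb1, Finset.prod_const, Finset.card_univ, hD.neg_one_pow] at this
  exact absurd this (by decide)

end CubeProduct

/-! ### The excluded dimensions and the theorem -/

theorem not_hasCrossing_three_one :
    ¬ HasCrossing (hypercube 3) (hypercube 1) (Fin 3) (Fin 1) := by
  intro h
  have hg : SwapsParity hypercubeParity (fun s : Finset (Fin 1) => symmDiff s {0}) :=
    ⟨fun s => symmDiff_symmDiff_cancel_right _ _, fun s => hypercubeParity_of_adj _ _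
      ((hypercube_adj_iff _ _).2 ⟨0, rfl⟩)⟩
  refine not_hasCrossing_cube (parW := hypercubeParity) hypercubeParity_of_adj (by decide) hg ?_
    (h.map cubeIso.symm SimpleGraph.Iso.refl)
  intro U hU
  -- The only matching on the one-dimensional side is the reference matching, so its relative
  -- permutation is the identity.
  refine Finset.prod_eq_one fun d _ => ?_
  have hUd : ∀ x s, U x d s = symmDiff s {0} := fun x s => by
    obtain ⟨i, hi⟩ := (hypercube_adj_iff _ _).1 ((hU x).adj d s)
    rw [← hi, Subsingleton.elim i 0]
  refine (congrArg Equiv.Perm.sign (Equiv.ext fun v => Subtype.ext ?_)).trans Equiv.Perm.sign_one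
  simp [relPerm, hUd]

theorem not_hasCrossing_three_three :
    ¬ HasCrossing (hypercube 3) (hypercube 3) (Fin 3) (Fin 3) := by
  intro h
  have hg : SwapsParity cubeParity (cubeFlip 0) :=
    ⟨cubeFlip_flip 0, fun v => cubeParity_of_adj _ _ ⟨0, rfl⟩⟩
  refine not_hasCrossing_cube (parW := cubeParity) cubeParity_of_adj (by decide) hg ?_
    (h.map cubeIso.symm cubeIso.symm)
  intro U hU
  -- Exchanging the two cubes turns columns into layers, so the sign formula for layers covers the
  -- other side too.
  rw [← prod_sign_layers (parW := cubeParity) hU]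
  refine Finset.prod_congr rfl fun d _ => ?_
  exact sign_relPerm_conj _ _ _ _ (Equiv.prodComm _ _) (fun v => Bool.xor_comm _ _)
    (fun _ => rfl) (fun _ => rfl)

theorem theorem4 (k l : ℕ) (hk : 1 ≤ k) (hl : 1 ≤ l) :
    (∃ M : Fin (k + l) → (hypercube (k + l)).Subgraph,
      IsOneFactorization M ∧ IsDirectionRespecting M ∧
        Nonempty (hamiltonPairGraph M ≃g completeBipartiteGraph (Fin k) (Fin l))) ↔
      ¬ ((k = 3 ∧ l = 1) ∨ (k = 1 ∧ l = 3) ∨ (k = 3 ∧ l = 3)) := by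
  constructor
  · rintro ⟨M, h1, h2, ⟨e⟩⟩
    have h := hasCrossing_of_directionRespecting hk hl h1 h2 e
    rintro (⟨rfl, rfl⟩ | ⟨rfl, rfl⟩ | ⟨rfl, rfl⟩)
    · exact not_hasCrossing_three_one h
    · exact not_hasCrossing_three_one h.symm
    · exact not_hasCrossing_three_three h
  · exact fun h => exists_directionRespecting_of_hasCrossing hk hl
      (hypercube_hasCrossing k l hk hl h)
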